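/- **Conventions.** Vocabularies are many-sorted, with finitary relation, function and constant symbols; all sorts of a structure are nonempty, and the cardinality of a structure is its total number of elements. A *logic* $\mathcal L$ assigns to each vocabulary $\tau$ a collection $\mathcal L[\tau]$ of sentences, with a satisfaction relation $\models_{\mathcal L}$ between $\tau$-structures and sentences that is invariant under isomorphism and has the inclusion, reduct and renaming properties (if $\rho$ renames $\sigma$ injectively into $\tau$, each $\varphi\in\mathcal L[\sigma]$ has a counterpart in $\mathcal L[\tau]$ that holds in $\mathfrak A$ iff $\varphi$ holds in the $\rho$-reduct of $\mathfrak A$). $\mathcal L$ is *regular* if it contains the atomic sentences of first-order logic and is closed (up to equivalence) under negation, conjunction, existential quantification over a constant, relativization (to nonempty subsets of the sorts, closed under constants and functions), and substitution (simultaneous replacement of relation, function and constant symbols by $\mathcal L$-definitions). $\mathfrak B$ is an *$\mathcal L$-elementary extension* of $\mathfrak A$ if, up to isomorphism, $\mathfrak A\subseteq\mathfrak B$ and $(\mathfrak A,a)_{a\in A}$, $(\mathfrak B,a)_{a\in A}$ satisfy the same $\mathcal L$-sentences. For a cardinal $\kappa$, let $S_\kappa(\kappa)$ be the set of subsets of $\kappa$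 of cardinality $<\kappa$; $X\subseteq S_\kappa(\kappa)$ is *cofinal* if each $x\in S_\kappa(\kappa)$ is contained in some $y\in X$. Let $\lambda\ge\mu$ be infinite cardinals, let $V_0$ and $V$ be cofinal in $S_\lambda(\lambda)$, and let $W$ be cofinal in $S_\mu(\mu)$. Let $\mathfrak A'=\langle\lambda,R,R_v\rangle_{v\in V\cup W}$, where $R(\gamma)$ iff $\gamma<\mu$, and $R_v(\gamma)$ iff $\gamma\in v$. $\mathcal L$ is *$[\lambda]$-compact* if, for every set $\Sigma$ of $\mathcal L$-sentences and all $\mathcal L$-sentences $(\varphi_v)_{v\in V_0}$ (of the same vocabulary), if $\Sigma\cup\{\varphi_v\mid v\in V_0,\ \gamma\notin v\}$ has a model for every $\gamma\in\lambda$, then $\Sigma\cup\{\varphi_v\mid v\in V_0\}$ has a model. A *limit ultrafilter* $(D,\mathcal V)$ is an ultrafilter $D$ over a set $I$ together with a filter $\mathcal V$ over $I\times I$. The corresponding limit ultrapower of $\mathfrak A$ is the substructure of the ultrapower $\prod_D\mathfrak A$ whose elements are the classes $f/D$ of functions $f$ with $\{(i,j)\mid f(i)=f(j)\}\in\mathcal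 V$. $(D,\mathcal V)$ is *$\lambda$-decomposable* if there is $f:I\to\lambda$ such that $\{(i,j)\mid f(i)=f(j)\}\in\mathcal V$ and $f^{-1}(v)\notin D$ for every $v\subseteq\lambda$ with $|v|<\lambda$. $\mathbf F(\mathcal L)$ is the class of all $(D,\mathcal V,\nu)$ such that, for every structure $\mathfrak A$ of cardinality $\le\nu$, the limit ultrapower of $\mathfrak A$ by $(D,\mathcal V)$ is an $\mathcal L$-elementary extension of $\mathfrak A$ via the diagonal embedding. **Proposition.** Let $\mathcal L$ be a regular logic, and let $\lambda,\mu,V_0,V,W$ be as above. The following are equivalent. (a) $\mathcal L$ is $[\lambda]$-compact. (b) Every many-sorted expansion $\mathfrak A$ of $\mathfrak A'$ (that is, $\mathfrak A$ has a larger vocabulary, possibly with new sorts, and its reduct to the vocabulary of $\mathfrak A'$ is $\mathfrak A'$) has an $\mathcal L$-elementary extension $\mathfrak B$ with an element $x$, of the sort of $\lambda$, such that $\mathfrak B\models\neg R_v(x)$ for every $v\in V$. (c) For every infinite cardinal $\nu$ there is a $\lambda$-decomposable limit ultrafilter $(D,\mathcal V)$ such that $(D,\mathcal V,\nu)\in\mathbf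 F(\mathcal L)$. In particular, none of the conditions depends on the choice of $V_0$, $\mu$, $V$, $W$. -/

import Mathlib

open Cardinal

universe u v

noncomputable section

namespace ManySorted

/-! ## Many-sorted vocabularies and structures -/

/-- Finitary relation, function and constant symbols over a set `S` of sorts, classified by
the sorts of their arguments (and of their values). -/
structure Signature (S : Type u) : Type (u + 1) where
  Rel : {n : ℕ} → (Fin n → S) → Type u
  Func : {n : ℕ} → (Fin n → S) → S → Type u
  Const : S → Type u

/-- A many-sorted vocabulary. -/
structure Vocab : Type (u + 1) where
  Srt : Type u
  sig : Signature.{u} Srt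

/-- Disjoint union of two sets of symbols over the same sorts. -/
def Signature.sum {S : Type u} (E F : Signature.{u} S) : Signature.{u} S where
  Rel s := E.Rel s ⊕ F.Rel s
  Func s t := E.Func s t ⊕ F.Func s t
  Const t := E.Const t ⊕ F.Const t

/-- The vocabulary `τ ∪ E`, where `E` is a set of new symbols over the sorts of `τ`. -/
def Vocab.extend (τ : Vocab.{u}) (E : Signature.{u} τ.Srt) : Vocab.{u} where
  Srt := τ.Srt
  sig := τ.sig.sum E

/-- An interpretation of the symbols of `E` on a family of domains `M`. -/
structure Interp {S : Type u} (E : Signature.{u} S) (M : S → Type u) : Type u where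
  rel : {n : ℕ} → {s : Fin n → S} → E.Rel s → (∀ i, M (s i)) → Prop
  func : {n : ℕ} → {s : Fin n → S} → {t : S} → E.Func s t → (∀ i, M (s i)) → M t
  const : {t : S} → E.Const t → M t

/-- Interpretations of `E` and of `F` together interpret their disjoint union. -/
def Interp.sum {S : Type u} {E F : Signature.{u} S} {M : S → Type u}
    (a : Interp E M) (b : Interp F M) : Interp (E.sum F) M where
  rel r x := Sum.elim (fun r => a.rel r x) (fun r => b.rel r x) r
  func f x := Sum.elim (fun f => a.func f x) (fun f => b.func f x) f
  const c := Sum.elim (fun c => a.const c) (fun c => b.const c) c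

/-- A many-sorted structure (all domains are nonempty). -/
structure Str (τ : Vocab.{u}) : Type (u + 1) where
  carrier : τ.Srt → Type u
  nonempty : ∀ s, Nonempty (carrier s)
  interp : Interp τ.sig carrier

/-- The cardinality of a many-sorted structure: the total number of its elements. -/
def Str.card {τ : Vocab.{u}} (A : Str τ) : Cardinal.{u} := #(Σ s, A.carrier s)

/-- The expansion of `A` by an interpretation of the new symbols. -/
def Str.expand {τ : Vocab.{u}} (A : Str τ) {E : Signature.{u} τ.Srt} (J : Interp E A.carrier) :
    Str (τ.extend E) where
  carrier := A.carrier
  nonempty := A.nonempty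
  interp := A.interp.sum J

/-- Isomorphisms of many-sorted structures. -/
structure Iso {τ : Vocab.{u}} (A B : Str τ) : Type u where
  equiv : ∀ s, A.carrier s ≃ B.carrier s
  map_rel : ∀ {n : ℕ} {s : Fin n → τ.Srt} (r : τ.sig.Rel s) (x : ∀ i, A.carrier (s i)),
    A.interp.rel r x ↔ B.interp.rel r (fun i => equiv (s i) (x i))
  map_func : ∀ {n : ℕ} {s : Fin n → τ.Srt} {t : τ.Srt} (f : τ.sig.Func s t)
    (x : ∀ i, A.carrier (s i)),
    equiv t (A.interp.func f x) = B.interp.func f (fun i => equiv (s i) (x i))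
  map_const : ∀ {t : τ.Srt} (c : τ.sig.Const t), equiv t (A.interp.const c) = B.interp.const c

/-- Maps of vocabularies, respecting sorts and kinds of symbols. -/
structure VocabHom (σ τ : Vocab.{u}) : Type u where
  srt : σ.Srt → τ.Srt
  rel : {n : ℕ} → {s : Fin n → σ.Srt} → σ.sig.Rel s → τ.sig.Rel (fun i => srt (s i))
  func : {n : ℕ} → {s : Fin n → σ.Srt} → {t : σ.Srt} → σ.sig.Func s t →
    τ.sig.Func (fun i => srt (s i)) (srt t)
  const : {t : σ.Srt} → σ.sig.Const t → τ.sig.Const (srt t)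

/-- An injective map of vocabularies is a renaming of `σ` onto a subvocabulary of `τ`. -/
structure VocabHom.IsInjective {σ τ : Vocab.{u}} (ρ : VocabHom σ τ) : Prop where
  srt : Function.Injective ρ.srt
  rel : ∀ {n : ℕ} {s : Fin n → σ.Srt}, Function.Injective (fun r : σ.sig.Rel s => ρ.rel r)
  func : ∀ {n : ℕ} {s : Fin n → σ.Srt} {t : σ.Srt},
    Function.Injective (fun f : σ.sig.Func s t => ρ.func f)
  const : ∀ {t : σ.Srt}, Function.Injective (fun c : σ.sig.Const t => ρ.const c)

/-- The (renamed) reduct of a `τ`-structure to `σ`. -/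
def Str.reduct {σ τ : Vocab.{u}} (A : Str τ) (ρ : VocabHom σ τ) : Str σ where
  carrier s := A.carrier (ρ.srt s)
  nonempty s := A.nonempty (ρ.srt s)
  interp :=
    { rel := fun r x => A.interp.rel (ρ.rel r) x
      func := fun f x => A.interp.func (ρ.func f) x
      const := fun c => A.interp.const (ρ.const c) }

/-! ### Special sets of new symbols -/

/-- A set of new constants: `C t` is the set of new constants of sort `t`. -/
def constSig {S : Type u} (C : S → Type u) : Signature.{u} S where
  Rel _ := PEmpty
  Func _ _ := PEmpty
  Const := C

def constInterp {S : Type u} {C M : S → Type u} (h : ∀ t, C t → M t) :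
    Interp (constSig C) M where
  rel r := nomatch r
  func f := nomatch f
  const c := h _ c

/-- The new constants `c_i` (`i : ι`), where `c_i` is of sort `s i`. -/
def tupleSig {S : Type u} {ι : Type} (s : ι → S) : Signature.{u} S :=
  constSig fun t => ULift.{u} {i : ι // s i = t}

/-- The interpretation of each `c_i` by `x i`. -/
def tupleInterp {S : Type u} {ι : Type} {s : ι → S} {M : S → Type u} (x : ∀ i, M (s i)) :
    Interp (tupleSig s) M :=
  constInterp fun _ c => c.down.2 ▸ x c.down.1

/-- The expansion `(A, x_i)_i` of `A` by constants for a tuple of elements. -/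
def Str.withTuple {τ : Vocab.{u}} (A : Str τ) {ι : Type} {s : ι → τ.Srt}
    (x : ∀ i, A.carrier (s i)) : Str (τ.extend (tupleSig s)) :=
  A.expand (tupleInterp x)

/-- One unary relation symbol for each sort. -/
inductive UnaryRel (S : Type u) : {n : ℕ} → (Fin n → S) → Type u
  | on (t : S) : UnaryRel S (fun _ : Fin 1 => t)

/-- One new unary relation symbol for each sort. -/
def unarySig (S : Type u) : Signature.{u} S where
  Rel s := UnaryRel S s
  Func _ _ := PEmpty
  Const _ := PEmpty

def unaryInterp {S : Type u} {M : S → Type u} (U : ∀ t, Set (M t)) :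
    Interp (unarySig S) M where
  rel r := match r with
    | UnaryRel.on t => fun x => x 0 ∈ U t
  func f := nomatch f
  const c := nomatch c

/-- `U` is a family of nonempty subsets of the domains of `A`, closed under the constants and
the functions of `A`. -/
structure Str.IsClosed {τ : Vocab.{u}} (A : Str τ) (U : ∀ t, Set (A.carrier t)) : Prop where
  nonempty : ∀ t, (U t).Nonempty
  func : ∀ {n : ℕ} {s : Fin n → τ.Srt} {t : τ.Srt} (f : τ.sig.Func s t)
    (x : ∀ i, A.carrier (s i)), (∀ i, x i ∈ U (s i)) → A.interp.func f x ∈ U t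
  const : ∀ {t : τ.Srt} (c : τ.sig.Const t), A.interp.const c ∈ U t

/-- The substructure of `A` on a closed family of subsets. -/
def Str.restrict {τ : Vocab.{u}} (A : Str τ) (U : ∀ t, Set (A.carrier t))
    (hU : A.IsClosed U) : Str τ where
  carrier t := ↥(U t)
  nonempty t := (hU.nonempty t).to_subtype
  interp :=
    { rel := fun r x => A.interp.rel r (fun i => (x i).1)
      func := fun f x => ⟨A.interp.func f (fun i => (x i).1), hU.func f _ (fun i => (x i).2)⟩
      const := fun c => ⟨A.interp.const c, hU.const c⟩ }

/-! ### Atomic sentences of first-order logic -/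

/-- Closed terms. -/
inductive ClosedTerm (τ : Vocab.{u}) : τ.Srt → Type u
  | const {t : τ.Srt} (c : τ.sig.Const t) : ClosedTerm τ t
  | app {n : ℕ} {s : Fin n → τ.Srt} {t : τ.Srt} (f : τ.sig.Func s t)
      (args : ∀ i, ClosedTerm τ (s i)) : ClosedTerm τ t

def ClosedTerm.eval {τ : Vocab.{u}} (A : Str τ) : {t : τ.Srt} → ClosedTerm τ t → A.carrier t
  | _, .const c => A.interp.const c
  | _, .app f args => A.interp.func f (fun i => (args i).eval A)

inductive AtomicSentence (τ : Vocab.{u}) : Type u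
  | eq {t : τ.Srt} (a b : ClosedTerm τ t) : AtomicSentence τ
  | rel {n : ℕ} {s : Fin n → τ.Srt} (r : τ.sig.Rel s) (args : ∀ i, ClosedTerm τ (s i)) :
      AtomicSentence τ

def AtomicSentence.Holds {τ : Vocab.{u}} (A : Str τ) : AtomicSentence τ → Prop
  | .eq a b => a.eval A = b.eval A
  | .rel r args => A.interp.rel r (fun i => (args i).eval A)

/-! ## Abstract logics -/

/-- An abstract logic: sentences of each vocabulary and a satisfaction relation, with the
isomorphism property and the inclusion, reduct and renaming properties. The last three are
stated together, for renamings of a vocabulary `σ` onto a part of a vocabulary `τ`. -/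
structure AbstractLogic where
  Sentence : Vocab.{u} → Type v
  Sat : {τ : Vocab.{u}} → Str τ → Sentence τ → Prop
  sat_iso : ∀ {τ : Vocab.{u}} (A B : Str τ), Iso A B → ∀ φ : Sentence τ, Sat A φ ↔ Sat B φ
  exists_rename : ∀ {σ τ : Vocab.{u}} (ρ : VocabHom σ τ), ρ.IsInjective → ∀ φ : Sentence σ,
    ∃ ψ : Sentence τ, ∀ A : Str τ, Sat A ψ ↔ Sat (A.reduct ρ) φ

namespace AbstractLogic

variable (L : AbstractLogic.{u, v})

/-- Definitions, by sentences of `L` in the vocabulary `τ` with extra constants for the arguments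
(and the value), of a set `E` of new relation, function and constant symbols. -/
structure Definitions (τ : Vocab.{u}) (E : Signature.{u} τ.Srt) where
  rel : {n : ℕ} → {s : Fin n → τ.Srt} → E.Rel s → L.Sentence (τ.extend (tupleSig s))
  func : {n : ℕ} → {s : Fin n → τ.Srt} → {t : τ.Srt} → E.Func s t →
    L.Sentence (τ.extend (tupleSig (fun o : Option (Fin n) => o.elim t s)))
  const : {t : τ.Srt} → E.Const t → L.Sentence (τ.extend (tupleSig (fun _ : Unit => t)))

/-- The tuple consisting of `y` and the `x i`. -/
def optionTuple {S : Type u} {M : S → Type u} {n : ℕ} {s : Fin n → S} {t : S}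
    (x : ∀ i, M (s i)) (y : M t) : ∀ o : Option (Fin n), M (o.elim t s)
  | none => y
  | some i => x i

/-- In `A`, the interpretation `J` of the new symbols is the one given by the definitions. -/
structure Definitions.DefinesIn {L : AbstractLogic.{u, v}} {τ : Vocab.{u}}
    {E : Signature.{u} τ.Srt} (δ : L.Definitions τ E) (A : Str τ) (J : Interp E A.carrier) :
    Prop where
  rel : ∀ {n : ℕ} {s : Fin n → τ.Srt} (r : E.Rel s) (x : ∀ i, A.carrier (s i)),
    J.rel r x ↔ L.Sat (A.withTuple x) (δ.rel r)
  func : ∀ {n : ℕ} {s : Fin n → τ.Srt} {t : τ.Srt} (f : E.Func s t)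
    (x : ∀ i, A.carrier (s i)) (y : A.carrier t),
    J.func f x = y ↔ L.Sat (A.withTuple (optionTuple x y)) (δ.func f)
  const : ∀ {t : τ.Srt} (c : E.Const t) (y : A.carrier t),
    J.const c = y ↔ L.Sat (A.withTuple (s := fun _ : Unit => t) (fun _ => y)) (δ.const c)

/-- Regular logics: closure under atomic sentences, negation, conjunction, particularization,
relativization and substitution. -/
structure IsRegular : Prop where
  atom : ∀ {τ : Vocab.{u}} (α : AtomicSentence τ),
    ∃ ψ : L.Sentence τ, ∀ A : Str τ, L.Sat A ψ ↔ α.Holds A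
  neg : ∀ {τ : Vocab.{u}} (φ : L.Sentence τ),
    ∃ ψ : L.Sentence τ, ∀ A : Str τ, L.Sat A ψ ↔ ¬ L.Sat A φ
  conj : ∀ {τ : Vocab.{u}} (φ₁ φ₂ : L.Sentence τ),
    ∃ ψ : L.Sentence τ, ∀ A : Str τ, L.Sat A ψ ↔ (L.Sat A φ₁ ∧ L.Sat A φ₂)
  particularization : ∀ {τ : Vocab.{u}} (t : τ.Srt)
    (φ : L.Sentence (τ.extend (tupleSig (fun _ : Unit => t)))),
    ∃ ψ : L.Sentence τ, ∀ A : Str τ,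
      L.Sat A ψ ↔ ∃ a : A.carrier t, L.Sat (A.withTuple (s := fun _ : Unit => t) (fun _ => a)) φ
  relativization : ∀ {τ : Vocab.{u}} (φ : L.Sentence τ),
    ∃ ψ : L.Sentence (τ.extend (unarySig τ.Srt)),
      ∀ (A : Str τ) (U : ∀ t, Set (A.carrier t)) (hU : A.IsClosed U),
        L.Sat (A.expand (unaryInterp U)) ψ ↔ L.Sat (A.restrict U hU) φ
  substitution : ∀ {τ : Vocab.{u}} {E : Signature.{u} τ.Srt} (δ : L.Definitions τ E)
    (φ : L.Sentence (τ.extend E)),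
    ∃ ψ : L.Sentence τ, ∀ (A : Str τ) (J : Interp E A.carrier), δ.DefinesIn A J →
      (L.Sat A ψ ↔ L.Sat (A.expand J) φ)

/-- `h : A → B` is `L`-elementary: `(A, a)_{a ∈ A}` and `(B, h a)_{a ∈ A}` satisfy the same
sentences of `L`. Thus, up to isomorphism, `B` is an `L`-elementary extension of `A`. -/
def IsElementary {τ : Vocab.{u}} (A B : Str τ) (h : ∀ s, A.carrier s → B.carrier s) : Prop :=
  ∀ φ : L.Sentence (τ.extend (constSig A.carrier)),
    L.Sat (A.expand (constInterp fun _ a => a)) φ ↔ L.Sat (B.expand (constInterp h)) φ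

/-- The set `T` of sentences has a model. -/
def HasModel {τ : Vocab.{u}} (T : Set (L.Sentence τ)) : Prop :=
  ∃ A : Str τ, ∀ φ ∈ T, L.Sat A φ

end AbstractLogic

/-! ## Cofinal families and `[lam]`-compactness -/

/-- The underlying set of (the initial ordinal) `lam`. -/
abbrev Base (lam : Cardinal.{u}) : Type u := lam.ord.ToType

theorem nonempty_base {lam : Cardinal.{u}} (h : ℵ₀ ≤ lam) : Nonempty (Base lam) := by
  rw [← Cardinal.mk_ne_zero_iff, Cardinal.mk_ord_toType]
  exact (Cardinal.aleph0_pos.trans_le h).ne'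

/-- `V` is a cofinal subset of the set of all subsets of `X` of cardinality `< kap`. -/
def IsCofinalFamily {Y : Type u} (X : Set Y) (kap : Cardinal.{u}) (V : Set (Set Y)) : Prop :=
  (∀ v ∈ V, v ⊆ X ∧ #v < kap) ∧ ∀ x : Set Y, x ⊆ X → #x < kap → ∃ v ∈ V, x ⊆ v

/-- The ordinals `< mu`, inside `lam`. -/
def below (lam mu : Cardinal.{u}) : Set (Base lam) :=
  {γ | (Ordinal.ToType.toOrd γ).1 < mu.ord}

/-- `[lam]`-compactness, relative to a cofinal family `V` of subsets of `lam` of cardinality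
`< lam`. -/
def AbstractLogic.IsCompactRelTo (L : AbstractLogic.{u, v}) (lam : Cardinal.{u})
    (V : Set (Set (Base lam))) : Prop :=
  ∀ (τ : Vocab.{u}) (S : Set (L.Sentence τ)) (φ : V → L.Sentence τ),
    (∀ γ : Base lam, L.HasModel (S ∪ {ψ | ∃ v : V, γ ∉ v.1 ∧ φ v = ψ})) →
      L.HasModel (S ∪ Set.range φ)

/-! ## The model `⟨lam, R, R_v⟩` for `v ∈ V ∪ W` -/

/-- The unary relation symbols `R` and `R_v`, for `v ∈ F`. -/
inductive BaseRel {Y : Type u} (F : Set (Set Y)) : {n : ℕ} → (Fin n → PUnit.{u + 1}) → Type u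
  | R : BaseRel F (fun _ : Fin 1 => PUnit.unit)
  | Rv (v : F) : BaseRel F (fun _ : Fin 1 => PUnit.unit)

/-- The one-sorted vocabulary with the symbols `R` and `R_v`, for `v ∈ F`. -/
def baseVocab {Y : Type u} (F : Set (Set Y)) : Vocab.{u} where
  Srt := PUnit
  sig :=
    { Rel := fun s => BaseRel F s
      Func := fun _ _ => PEmpty
      Const := fun _ => PEmpty }

/-- The model with universe `Y`, where `R` is interpreted by `X` and each `R_v` by `v`. -/
def baseModel {Y : Type u} (hY : Nonempty Y) (X : Set Y) (F : Set (Set Y)) :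
    Str (baseVocab F) where
  carrier _ := Y
  nonempty _ := hY
  interp :=
    { rel := fun r => match r with
        | BaseRel.R => fun x => x 0 ∈ X
        | BaseRel.Rv v => fun x => x 0 ∈ v.1
      func := fun f => nomatch f
      const := fun c => nomatch c }

/-- Every many-sorted expansion `A` of `⟨lam, R, R_v⟩`, where `R` is the set of all ordinals
`< mu` and `v ∈ V ∪ W`, has an `L`-elementary extension `B` with an element `x`, of the sort
of `lam`, outside all `R_v`, `v ∈ V`. -/
def AbstractLogic.ExpansionsExtend (L : AbstractLogic.{u, v}) (lam mu : Cardinal.{u})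
    (hlam : ℵ₀ ≤ lam) (V W : Set (Set (Base lam))) : Prop :=
  ∀ (τ : Vocab.{u}) (ρ : VocabHom (baseVocab (V ∪ W)) τ), ρ.IsInjective →
    ∀ A : Str τ, Nonempty (Iso (A.reduct ρ) 
        (baseModel (nonempty_base hlam) (below lam mu) (V ∪ W))) →
      ∃ (B : Str τ) (h : ∀ s, A.carrier s → B.carrier s), L.IsElementary A B h ∧
        ∃ x : (B.reduct ρ).carrier PUnit.unit,
          ∀ (v : Set (Base lam)) (hv : v ∈ V),
            ¬ (B.reduct ρ).interp.rel (BaseRel.Rv ⟨v, Or.inl hv⟩) (fun _ => x)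

/-! ## Limit ultrafilters and limit ultrapowers -/

/-- A limit ultrafilter `(D, V)`: an ultrafilter `D` over `I` and a filter `V` over `I × I`. -/
structure LimitUltrafilter : Type (u + 1) where
  I : Type u
  D : Ultrafilter I
  V : Filter (I × I)

namespace LimitUltrafilter

variable (P : LimitUltrafilter.{u})

/-- The set `{(i, j) | f i = f j}`. -/
def eqSet {I M : Type*} (f : I → M) : Set (I × I) := {p | f p.1 = f p.2}

/-- The functions `f : I → M` with `eqSet f ∈ V`. -/
def LimitFun (M : Type u) : Type u := {f : P.I → M // eqSet f ∈ P.V}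

/-- Equality modulo `D`. -/
def limitSetoid (M : Type u) : Setoid (P.LimitFun M) where
  r f g := ∀ᶠ i in (P.D : Filter P.I), f.1 i = g.1 i
  iseqv :=
    { refl := fun _ => Filter.Eventually.of_forall fun _ => rfl
      symm := fun h => h.mono fun _ hi => hi.symm
      trans := fun h₁ h₂ => (h₁.and h₂).mono fun _ hi => hi.1.trans hi.2 }

/-- The limit ultrapower of a set `M`. -/
def Power (M : Type u) : Type u := Quotient (P.limitSetoid M)

/-- A constant function, as an element of the limit ultrapower. -/
def diag {M : Type u} (a : M) : P.Power M :=
  Quotient.mk (P.limitSetoid M) ⟨fun _ => a, by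
    have h : eqSet (fun _ : P.I => a) = Set.univ := by ext; simp [eqSet]
    rw [h]
    exact Filter.univ_mem⟩

/-- A representative of an element of the limit ultrapower. -/
def rep {M : Type u} (x : P.Power M) : P.LimitFun M := Quotient.out x

theorem eqSet_comp_mem {n : ℕ} {M : Fin n → Type u} {N : Type u} (F : (∀ i, M i) → N)
    (g : ∀ i, P.LimitFun (M i)) : eqSet (fun j => F (fun i => (g i).1 j)) ∈ P.V := by
  have h : (⋂ i, eqSet (g i).1) ∈ P.V := Filter.iInter_mem.2 fun i => (g i).2
  refine Filter.mem_of_superset h fun p hp => ?_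
  have hp' : ∀ i, (g i).1 p.1 = (g i).1 p.2 := fun i => Set.mem_iInter.1 hp i
  simp only [eqSet, Set.mem_ofPred_eq, hp']

/-- The limit ultrapower of the structure `A`. Relations and functions are computed on
representatives (the result does not depend on their choice). -/
def power {τ : Vocab.{u}} (A : Str τ) : Str τ where
  carrier s := P.Power (A.carrier s)
  nonempty s := (A.nonempty s).map P.diag
  interp :=
    { rel := fun r x => ∀ᶠ j in (P.D : Filter P.I), A.interp.rel r (fun i => (P.rep (x i)).1 j)
      func := fun f x => Quotient.mk (P.limitSetoid _)
        ⟨fun j => A.interp.func f (fun i => (P.rep (x i)).1 j),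
          P.eqSet_comp_mem (A.interp.func f) (fun i => P.rep (x i))⟩
      const := fun c => P.diag (A.interp.const c) }

/-- `lam`-decomposability of a limit ultrafilter. -/
def IsDecomposable (lam : Cardinal.{u}) : Prop :=
  ∃ f : P.I → Base lam, eqSet f ∈ P.V ∧ ∀ v : Set (Base lam), #v < lam → f ⁻¹' v ∉ P.D

end LimitUltrafilter

/-- The family `F(L)`: all `((D, V), nu)` such that the limit ultrapower by `(D, V)` of every
structure of cardinality at most `nu` is an `L`-elementary extension of it, via the diagonal
embedding. -/
def AbstractLogic.limitFamily (L : AbstractLogic.{u, v}) :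
    Set (LimitUltrafilter.{u} × Cardinal.{u}) :=
  {q | ∀ (τ : Vocab.{u}) (A : Str τ), A.card ≤ q.2 →
    L.IsElementary A (q.1.power A) (fun _ a => q.1.diag a)}

end ManySorted

end

/-!
Call a structure complete if all its relations, functions and elements are named.

(a) implies (b): over a complete expansion of `A`, the element `γ` of `λ` satisfies all the formulas
`x ∉ w` with `γ ∉ w`, so compactness gives an equivalent structure with an element outside all the
sets `w`. Since the elements of `A` are named, equivalence makes this an elementary extension.

(b) implies (c): every structure `B` that is `L`-equivalent to a complete structure `A` is a limit
ultrapower of `A`. The ultrafilter lives on the functions that choose an element of `A` for each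
element of `B`: what `L` expresses of finitely many elements of `B` holds of their values for almost
all choices. The limit functions are those that depend on finitely many values, and by completeness
each of them is given by a function symbol. The element of `B` outside all small sets is the class
of a function that decomposes the ultrafilter. All structures of cardinality at most `ν` are reducts
of a single complete structure, whose equivalence with its limit ultrapower they inherit.

(c) implies (a): put the models `A γ` of the parts of the theory side by side, with `γ` ranging over
a new sort. The fibre of the limit ultrapower over the class of `f` satisfies a sentence if and only
if `A (f j)` does for almost all `j`, by relativization to the fibres and Łoś's theorem. If `f`
decomposes the ultrafilter then `f j ∉ v` for almost all `j`, so this fibre is a model of the whole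
theory.
-/

namespace ManySorted

/-! ### Maps of vocabularies -/

/-- The inclusion of a vocabulary in an extension of it. -/
def Vocab.incl (τ : Vocab.{u}) (E : Signature.{u} τ.Srt) : VocabHom τ (τ.extend E) where
  srt s := s
  rel r := Sum.inl r
  func f := Sum.inl f
  const c := Sum.inl c

namespace VocabHom

variable {σ τ υ : Vocab.{u}}

/-- The identity map of a vocabulary. -/
def id (τ : Vocab.{u}) : VocabHom τ τ where
  srt s := s
  rel r := r
  func f := f
  const c := c

/-- The composition of two maps of vocabularies. -/
def comp (ρ : VocabHom τ υ) (π : VocabHom σ τ) : VocabHom σ υ where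
  srt s := ρ.srt (π.srt s)
  rel r := ρ.rel (π.rel r)
  func f := ρ.func (π.func f)
  const c := ρ.const (π.const c)

/-- The extension of a map of vocabularies `ρ` to a set `C` of new constants, by `c`. -/
def constLift (ρ : VocabHom σ τ) {C : σ.Srt → Type u}
    (c : ∀ t, C t → τ.sig.Const (ρ.srt t)) : VocabHom (σ.extend (constSig C)) τ where
  srt := ρ.srt
  rel r := Sum.elim ρ.rel (fun r => nomatch r) r
  func f := Sum.elim ρ.func (fun f => nomatch f) f
  const a := Sum.elim ρ.const (c _) a

end VocabHom

/-- A structure for a vocabulary with new constants `C` is determined by its reduct and by the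
values of these constants. -/
def Str.isoExpandConst {τ : Vocab.{u}} {C : τ.Srt → Type u} (B : Str (τ.extend (constSig C)))
    {h : ∀ t, C t → B.carrier t} (hB : ∀ t c, B.interp.const (Sum.inr c) = h t c) :
    Iso B ((B.reduct (τ.incl _)).expand (constInterp h)) where
  equiv _ := Equiv.refl _
  map_rel
    | .inl _, _ => Iff.rfl
    | .inr r, _ => nomatch r
  map_func
    | .inl _, _ => rfl
    | .inr f, _ => nomatch f
  map_const
    | .inl _ => rfl
    | .inr c => hB _ c

/-- The inverse of an isomorphism. -/
def Iso.symm {τ : Vocab.{u}} {A B : Str τ} (e : Iso A B) : Iso B A where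
  equiv s := (e.equiv s).symm
  map_rel r x := by simp only [e.map_rel, Equiv.apply_symm_apply]
  map_func f x := by simp only [Equiv.symm_apply_eq, e.map_func, Equiv.apply_symm_apply]
  map_const c := by simp only [Equiv.symm_apply_eq, e.map_const]

/-! ### Expressible predicates -/

namespace AbstractLogic

/-- The predicate `Q` of structures and tuples is expressed by a sentence of `L` with constants
for the entries of the tuple. -/
def Expressible (L : AbstractLogic.{u, v}) {τ : Vocab.{u}} {ι : Type} (s : ι → τ.Srt)
    (Q : ∀ A : Str τ, (∀ i, A.carrier (s i)) → Prop) : Prop :=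
  ∃ φ : L.Sentence (τ.extend (tupleSig s)), ∀ A x, L.Sat (A.withTuple x) φ ↔ Q A x

/-- The constant symbol for the `i`-th entry of a tuple, as a term. -/
def argTerm {τ : Vocab.{u}} {ι : Type} (s : ι → τ.Srt) (i : ι) :
    ClosedTerm (τ.extend (tupleSig s)) (s i) :=
  .const (τ := τ.extend (tupleSig s)) (Sum.inr ⟨⟨i, rfl⟩⟩)

namespace IsRegular

variable {L : AbstractLogic.{u, v}} {τ : Vocab.{u}} {ι : Type} {s : ι → τ.Srt}
  {Q Q' : ∀ A : Str τ, (∀ i, A.carrier (s i)) → Prop}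

theorem expressible_not (hL : L.IsRegular) (h : L.Expressible s Q) :
    L.Expressible s fun A x => ¬ Q A x := by
  obtain ⟨φ, hφ⟩ := h
  obtain ⟨ψ, hψ⟩ := hL.neg φ
  exact ⟨ψ, fun A x => by rw [hψ, hφ]⟩

theorem expressible_and (hL : L.IsRegular) (h : L.Expressible s Q) (h' : L.Expressible s Q') :
    L.Expressible s fun A x => Q A x ∧ Q' A x := by
  obtain ⟨φ, hφ⟩ := h
  obtain ⟨φ', hφ'⟩ := h'
  obtain ⟨ψ, hψ⟩ := hL.conj φ φ'
  exact ⟨ψ, fun A x => by rw [hψ, hφ, hφ']⟩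

theorem expressible_imp (hL : L.IsRegular) (h : L.Expressible s Q) (h' : L.Expressible s Q') :
    L.Expressible s fun A x => Q A x → Q' A x := by
  simpa only [not_and_not_right] using
    hL.expressible_not (hL.expressible_and h (hL.expressible_not h'))

theorem expressible_iff (hL : L.IsRegular) (h : L.Expressible s Q) (h' : L.Expressible s Q') :
    L.Expressible s fun A x => Q A x ↔ Q' A x := by
  simpa only [iff_iff_implies_and_implies] using
    hL.expressible_and (hL.expressible_imp h h') (hL.expressible_imp h' h)

theorem expressible_atomic (hL : L.IsRegular) (α : AtomicSentence (τ.extend (tupleSig s))) :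
    L.Expressible s fun A x => α.Holds (A.withTuple x) :=
  (hL.atom α).imp fun _ hψ _ _ => hψ _

theorem expressible_rel (hL : L.IsRegular) {n : ℕ} (k : Fin n → ι)
    (r : τ.sig.Rel fun i => s (k i)) :
    L.Expressible s fun A x => A.interp.rel r fun i => x (k i) :=
  hL.expressible_atomic (.rel (τ := τ.extend (tupleSig s)) (Sum.inl r) fun i => argTerm s (k i))

theorem expressible_func (hL : L.IsRegular) {n : ℕ} (k : Fin n → ι) (j : ι)
    (f : τ.sig.Func (fun i => s (k i)) (s j)) :
    L.Expressible s fun A x => A.interp.func f (fun i => x (k i)) = x j :=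
  hL.expressible_atomic (.eq (τ := τ.extend (tupleSig s))
    (.app (τ := τ.extend (tupleSig s)) (Sum.inl f) fun i => argTerm s (k i)) (argTerm s j))

theorem expressible_const (hL : L.IsRegular) (j : ι) (c : τ.sig.Const (s j)) :
    L.Expressible s fun A x => A.interp.const c = x j :=
  hL.expressible_atomic (.eq (τ := τ.extend (tupleSig s))
    (.const (τ := τ.extend (tupleSig s)) (Sum.inl c)) (argTerm s j))

theorem expressible_eq (hL : L.IsRegular) {t : τ.Srt} (i j : ι) :
    L.Expressible (fun _ : ι => t) fun _ x => x i = x j :=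
  hL.expressible_atomic (.eq (argTerm (fun _ => t) i) (argTerm (fun _ => t) j))

end IsRegular

end AbstractLogic

/-! ### Definable interpretations -/

/-- The relation symbols of `E`, moved along a map of sorts. -/
inductive Signature.MapRel {S T : Type u} (E : Signature.{u} S) (g : S → T) :
    {n : ℕ} → (Fin n → T) → Type u
  | mk {n : ℕ} {s : Fin n → S} (r : E.Rel s) : MapRel E g (fun i => g (s i))

/-- The function symbols of `E`, moved along a map of sorts. -/
inductive Signature.MapFunc {S T : Type u} (E : Signature.{u} S) (g : S → T) :
    {n : ℕ} → (Fin n → T) → T → Type u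
  | mk {n : ℕ} {s : Fin n → S} {t : S} (f : E.Func s t) : MapFunc E g (fun i => g (s i)) (g t)

/-- The constant symbols of `E`, moved along a map of sorts. -/
inductive Signature.MapConst {S T : Type u} (E : Signature.{u} S) (g : S → T) : T → Type u
  | mk {t : S} (c : E.Const t) : MapConst E g (g t)

/-- The symbols of `E`, moved along a map of sorts. -/
def Signature.map {S T : Type u} (E : Signature.{u} S) (g : S → T) : Signature.{u} T where
  Rel s := E.MapRel g s
  Func s t := E.MapFunc g s t
  Const t := E.MapConst g t

/-- An interpretation of `E` on the domains `M (g s)`, as an interpretation on `M` of the symbols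
moved along `g`. -/
def Interp.map {S T : Type u} {E : Signature.{u} S} {g : S → T} {M : T → Type u}
    (J : Interp E fun s => M (g s)) : Interp (E.map g) M where
  rel
    | .mk r => J.rel r
  func
    | .mk f => J.func f
  const
    | .mk c => J.const c

/-- The symbols of `σ` as new symbols over the sorts of `τ`. -/
def VocabHom.toMap (σ τ : Vocab.{u}) (g : σ.Srt → τ.Srt) :
    VocabHom σ (τ.extend (σ.sig.map g)) where
  srt := g
  rel r := Sum.inr (.mk r)
  func f := Sum.inr (.mk f)
  const c := Sum.inr (.mk c)

theorem VocabHom.toMap_isInjective {σ τ : Vocab.{u}} {g : σ.Srt → τ.Srt}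
    (hg : Function.Injective g) : (VocabHom.toMap σ τ g).IsInjective where
  srt := hg
  rel h := by injection Sum.inr_injective h
  func h := by injection Sum.inr_injective h
  const h := by injection Sum.inr_injective h

/-- The `σ`-structure on the domains `A.carrier (g s)` with the interpretation `J`. -/
def Str.pull {σ τ : Vocab.{u}} (A : Str τ) (g : σ.Srt → τ.Srt)
    (J : Interp σ.sig fun s => A.carrier (g s)) : Str σ where
  carrier s := A.carrier (g s)
  nonempty s := A.nonempty (g s)
  interp := J

namespace AbstractLogic

variable {L : AbstractLogic.{u, v}} {σ τ : Vocab.{u}}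

/-- The interpretations `J A` of `σ`, on domains of the `τ`-structures `A`, are defined by
sentences of `L` not depending on `A`. -/
structure IsDefinable (L : AbstractLogic.{u, v}) {g : σ.Srt → τ.Srt}
    (J : ∀ A : Str τ, Interp σ.sig fun s => A.carrier (g s)) : Prop where
  rel : ∀ {n : ℕ} {s : Fin n → σ.Srt} (r : σ.sig.Rel s),
    L.Expressible (fun i => g (s i)) fun A x => (J A).rel r x
  func : ∀ {n : ℕ} {s : Fin n → σ.Srt} {t : σ.Srt} (f : σ.sig.Func s t),
    L.Expressible (fun o : Option (Fin n) => o.elim (g t) fun i => g (s i))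
      fun A x => (J A).func f (fun i => x (some i)) = x none
  const : ∀ {t : σ.Srt} (c : σ.sig.Const t),
    L.Expressible (fun _ : Unit => g t) fun A x => (J A).const c = x ()

theorem IsDefinable.exists_sentence (hL : L.IsRegular) {g : σ.Srt → τ.Srt}
    (hg : Function.Injective g) {J : ∀ A : Str τ, Interp σ.sig fun s => A.carrier (g s)}
    (hJ : L.IsDefinable J) (φ : L.Sentence σ) :
    ∃ ψ : L.Sentence τ, ∀ A : Str τ, L.Sat A ψ ↔ L.Sat (A.pull g (J A)) φ := by
  obtain ⟨φ', hφ'⟩ := L.exists_rename _ (VocabHom.toMap_isInjective (τ := τ) hg) φ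
  let δ : L.Definitions τ (σ.sig.map g) :=
    { rel := fun | .mk r => (hJ.rel r).choose
      func := fun | .mk f => (hJ.func f).choose
      const := fun | .mk c => (hJ.const c).choose }
  have hδ (A : Str τ) : δ.DefinesIn A (J A).map :=
    { rel := fun | .mk r, x => ((hJ.rel r).choose_spec A x).symm
      func := fun | .mk f, x, y => ((hJ.func f).choose_spec A (optionTuple x y)).symm
      const := fun | .mk c, y => ((hJ.const c).choose_spec A fun _ => y).symm }
  obtain ⟨ψ, hψ⟩ := hL.substitution δ φ'
  exact ⟨ψ, fun A => (hψ A _ (hδ A)).trans (hφ' _)⟩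

namespace IsRegular

theorem exists_rename_of_srt_injective (hL : L.IsRegular) (ρ : VocabHom σ τ)
    (hρ : Function.Injective ρ.srt) (φ : L.Sentence σ) :
    ∃ ψ : L.Sentence τ, ∀ A : Str τ, L.Sat A ψ ↔ L.Sat (A.reduct ρ) φ := by
  have hJ : L.IsDefinable fun A : Str τ => (A.reduct ρ).interp :=
    { rel := fun {n s} r => hL.expressible_rel (s := fun i => ρ.srt (s i)) id (ρ.rel r)
      func := fun {n s t} f => hL.expressible_func
        (s := fun o : Option (Fin n) => o.elim (ρ.srt t) fun i => ρ.srt (s i))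
        some none (ρ.func f)
      const := fun {t} c => hL.expressible_const (s := fun _ : Unit => ρ.srt t) () (ρ.const c) }
  exact hJ.exists_sentence hL hρ φ

theorem exists_rename_const (hL : L.IsRegular) (ρ : VocabHom σ τ)
    (hρ : Function.Injective ρ.srt) {C : σ.Srt → Type u}
    (c : ∀ t, C t → τ.sig.Const (ρ.srt t)) (φ : L.Sentence (σ.extend (constSig C))) :
    ∃ ψ : L.Sentence τ, ∀ A : Str τ,
      L.Sat A ψ ↔ L.Sat ((A.reduct ρ).expand (constInterp fun t a => A.interp.const (c t a))) φ :=
  (hL.exists_rename_of_srt_injective (ρ.constLift c) hρ φ).imp fun _ hψ A =>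
    (hψ A).trans (L.sat_iso _ _ (Str.isoExpandConst _ fun _ _ => rfl) φ)

theorem exists_rename_tuple (hL : L.IsRegular) (ρ : VocabHom σ τ)
    (hρ : Function.Injective ρ.srt) {ι : Type} {s : ι → σ.Srt}
    (c : ∀ i, τ.sig.Const (ρ.srt (s i))) (φ : L.Sentence (σ.extend (tupleSig s))) :
    ∃ ψ : L.Sentence τ, ∀ A : Str τ,
      L.Sat A ψ ↔ L.Sat ((A.reduct ρ).withTuple fun i => A.interp.const (c i)) φ := by
  obtain ⟨ψ, hψ⟩ := hL.exists_rename_const ρ hρ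
    (C := fun t => ULift {i // s i = t}) (fun _ k => k.down.2 ▸ c k.down.1) φ
  refine ⟨ψ, fun A => (hψ A).trans (iff_of_eq (congrArg (fun h => L.Sat
    ((A.reduct ρ).expand (constInterp h)) φ) ?_))⟩
  funext _ ⟨i, hi⟩
  subst hi
  rfl

variable {ι κ : Type}

theorem expressible_comp (hL : L.IsRegular) {s : ι → τ.Srt} (k : κ → ι)
    {Q : ∀ A : Str τ, (∀ j, A.carrier (s (k j))) → Prop}
    (hQ : L.Expressible (fun j => s (k j)) Q) :
    L.Expressible s fun A x => Q A fun j => x (k j) := by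
  obtain ⟨φ, hφ⟩ := hQ
  obtain ⟨ψ, hψ⟩ := hL.exists_rename_tuple (τ.incl (tupleSig s)) Function.injective_id
    (fun j => Sum.inr ⟨⟨k j, rfl⟩⟩) φ
  exact ⟨ψ, fun A x => (hψ _).trans (hφ A _)⟩

theorem expressible_reduct (hL : L.IsRegular) (ρ : VocabHom σ τ)
    (hρ : Function.Injective ρ.srt) {s : ι → σ.Srt}
    {Q : ∀ A : Str σ, (∀ i, A.carrier (s i)) → Prop} (hQ : L.Expressible s Q) :
    L.Expressible (fun i => ρ.srt (s i)) fun A x => Q (A.reduct ρ) x := by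
  obtain ⟨φ, hφ⟩ := hQ
  obtain ⟨ψ, hψ⟩ := hL.exists_rename_tuple ((τ.incl (tupleSig fun i => ρ.srt (s i))).comp ρ) hρ
    (fun i => Sum.inr ⟨⟨i, rfl⟩⟩) φ
  exact ⟨ψ, fun A x => (hψ _).trans (hφ (A.reduct ρ) _)⟩

theorem expressible_exists (hL : L.IsRegular) {n : ℕ} {s : Fin (n + 1) → τ.Srt}
    {Q : ∀ A : Str τ, (∀ i, A.carrier (s i)) → Prop} (hQ : L.Expressible s Q) :
    L.Expressible (fun i : Fin n => s i.succ) fun A x => ∃ a : A.carrier (s 0),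
      Q A (Fin.cons a x : ∀ i, A.carrier (s i)) := by
  obtain ⟨φ, hφ⟩ := hQ
  let τ' := τ.extend (tupleSig fun i : Fin n => s i.succ)
  let ρ : VocabHom τ (τ'.extend (tupleSig fun _ : Unit => s 0)) :=
    (τ'.incl _).comp (τ.incl _)
  obtain ⟨φ', hφ'⟩ := hL.exists_rename_tuple ρ Function.injective_id
    (Fin.cases (Sum.inr ⟨⟨(), rfl⟩⟩) fun i => Sum.inl (Sum.inr ⟨⟨i, rfl⟩⟩)) φ
  obtain ⟨ψ, hψ⟩ := hL.particularization (τ := τ') (s 0) φ'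
  refine ⟨ψ, fun A x => (hψ _).trans (exists_congr fun a => (hφ' _).trans ((iff_of_eq
    (congrArg (fun y => L.Sat (A.withTuple y) φ) ?_)).trans (hφ A _)))⟩
  funext i
  cases i using Fin.cases <;> rfl

theorem exists_sentence_iff_exists_tuple (hL : L.IsRegular) {n : ℕ} {s : Fin n → τ.Srt}
    {Q : ∀ A : Str τ, (∀ i, A.carrier (s i)) → Prop} (hQ : L.Expressible s Q) :
    ∃ ψ : L.Sentence τ, ∀ A : Str τ, L.Sat A ψ ↔ ∃ x, Q A x := by
  induction n with
  | zero =>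
    obtain ⟨φ, hφ⟩ := hQ
    obtain ⟨ψ, hψ⟩ := hL.exists_rename_tuple (VocabHom.id τ) Function.injective_id
      (fun i => i.elim0) φ
    refine ⟨ψ, fun A => (hψ A).trans ((hφ A _).trans ?_)⟩
    exact ⟨fun h => ⟨_, h⟩, fun ⟨x, hx⟩ => by rwa [Subsingleton.elim x] at hx⟩
  | succ n ih =>
    obtain ⟨ψ, hψ⟩ := ih (hL.expressible_exists hQ)
    refine ⟨ψ, fun A => (hψ A).trans ⟨?_, ?_⟩⟩
    · rintro ⟨x, a, h⟩
      exact ⟨_, h⟩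
    · rintro ⟨x, h⟩
      exact ⟨_, _, by rwa [← Fin.cons_self_tail x] at h⟩

end IsRegular

/-! ### Equivalence -/

/-- `A` and `B` satisfy the same sentences of `L`. -/
def Equivalent (L : AbstractLogic.{u, v}) (A B : Str τ) : Prop :=
  ∀ φ : L.Sentence τ, L.Sat A φ ↔ L.Sat B φ

namespace Equivalent

variable {A B : Str τ}

theorem trans {C : Str τ} (h : L.Equivalent A B) (h' : L.Equivalent B C) : L.Equivalent A C :=
  fun φ => (h φ).trans (h' φ)

theorem of_iso (e : Iso A B) : L.Equivalent A B := L.sat_iso A B e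

theorem of_forall_imp (hL : L.IsRegular) (h : ∀ φ, L.Sat A φ → L.Sat B φ) :
    L.Equivalent A B := by
  refine fun φ => ⟨h φ, fun hφ => by_contra fun hn => ?_⟩
  obtain ⟨ψ, hψ⟩ := hL.neg φ
  exact (hψ B).1 (h ψ ((hψ A).2 hn)) hφ

theorem reduct (hL : L.IsRegular) (h : L.Equivalent A B) (ρ : VocabHom σ τ)
    (hρ : Function.Injective ρ.srt) : L.Equivalent (A.reduct ρ) (B.reduct ρ) := by
  intro φ
  obtain ⟨ψ, hψ⟩ := hL.exists_rename_of_srt_injective ρ hρ φ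
  rw [← hψ, ← hψ, h]

variable {n : ℕ} {s : Fin n → τ.Srt} {Q : ∀ A : Str τ, (∀ i, A.carrier (s i)) → Prop}

theorem exists_iff (hL : L.IsRegular) (h : L.Equivalent A B) (hQ : L.Expressible s Q) :
    (∃ x, Q A x) ↔ ∃ y, Q B y := by
  obtain ⟨ψ, hψ⟩ := hL.exists_sentence_iff_exists_tuple hQ
  rw [← hψ, ← hψ, h]

theorem forall_iff (hL : L.IsRegular) (h : L.Equivalent A B) (hQ : L.Expressible s Q) :
    (∀ x, Q A x) ↔ ∀ y, Q B y := by
  simpa only [not_exists, not_not] using not_congr (h.exists_iff hL (hL.expressible_not hQ))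

end Equivalent

theorem IsElementary.reduct (hL : L.IsRegular) {A B : Str τ}
    {h : ∀ s, A.carrier s → B.carrier s} (hAB : L.IsElementary A B h) (ρ : VocabHom σ τ)
    (hρ : Function.Injective ρ.srt) :
    L.IsElementary (A.reduct ρ) (B.reduct ρ) fun s => h (ρ.srt s) := by
  intro φ
  obtain ⟨ψ, hψ⟩ := hL.exists_rename_const ((τ.incl (constSig A.carrier)).comp ρ) hρ
    (fun _ a => Sum.inr a) φ
  exact (hψ (A.expand (constInterp fun _ a => a))).symm.trans
    ((hAB ψ).trans (hψ (B.expand (constInterp h))))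

theorem IsElementary.equivalent (hL : L.IsRegular) {A B : Str τ}
    {h : ∀ s, A.carrier s → B.carrier s} (hAB : L.IsElementary A B h) : L.Equivalent A B :=
  Equivalent.reduct hL hAB (τ.incl _) Function.injective_id

end AbstractLogic

/-! ### Limit ultrapowers -/

namespace LimitUltrafilter

variable (P : LimitUltrafilter.{u})

/-- The element of the limit ultrapower represented by a function. -/
def toPower {M : Type u} (f : P.LimitFun M) : P.Power M := Quotient.mk (P.limitSetoid M) f

variable {P}

theorem toPower_eq_toPower {M : Type u} {f g : P.LimitFun M} :
    P.toPower f = P.toPower g ↔ ∀ᶠ j in (P.D : Filter P.I), f.1 j = g.1 j :=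
  Quotient.eq (r := P.limitSetoid M)

theorem toPower_rep {M : Type u} (x : P.Power M) : P.toPower (P.rep x) = x :=
  Quotient.out_eq (s := P.limitSetoid M) x

theorem toPower_surjective (M : Type u) : Function.Surjective (P.toPower (M := M)) :=
  fun x => ⟨_, toPower_rep x⟩

theorem eventually_rep_toPower {ι : Type*} [Finite ι] {M : ι → Type u}
    (g : ∀ i, P.LimitFun (M i)) :
    ∀ᶠ j in (P.D : Filter P.I), (fun i => (P.rep (P.toPower (g i))).1 j) = fun i => (g i).1 j :=
  (Filter.eventually_all.2 fun i => toPower_eq_toPower.1 (toPower_rep (P.toPower (g i)))).mono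
    fun _ hj => funext hj

variable {τ : Vocab.{u}} {n : ℕ} {s : Fin n → τ.Srt}

theorem power_rel (A : Str τ) (r : τ.sig.Rel s) (g : ∀ i, P.LimitFun (A.carrier (s i))) :
    (P.power A).interp.rel r (fun i => P.toPower (g i)) ↔
      ∀ᶠ j in (P.D : Filter P.I), A.interp.rel r fun i => (g i).1 j :=
  Filter.eventually_congr ((eventually_rep_toPower g).mono fun _ hj => by rw [hj])

theorem power_func (A : Str τ) {t : τ.Srt} (f : τ.sig.Func s t)
    (g : ∀ i, P.LimitFun (A.carrier (s i))) :
    (P.power A).interp.func f (fun i => P.toPower (g i)) =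
      P.toPower ⟨fun j => A.interp.func f fun i => (g i).1 j,
        P.eqSet_comp_mem (A.interp.func f) g⟩ :=
  toPower_eq_toPower.2 ((eventually_rep_toPower g).mono fun _ hj => congrArg _ hj)

theorem exists_toPower_eq {ι : Type*} {M : ι → Type u} (x : ∀ i, P.Power (M i)) :
    ∃ g : ∀ i, P.LimitFun (M i), (fun i => P.toPower (g i)) = x :=
  ⟨fun i => P.rep (x i), funext fun i => toPower_rep (x i)⟩

variable (P)

/-- The map of limit functions induced by a map of sets. -/
def mapFun {M N : Type u} (e : M → N) (f : P.LimitFun M) : P.LimitFun N :=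
  ⟨fun j => e (f.1 j), Filter.mem_of_superset f.2 fun _ hp => congrArg e hp⟩

/-- The bijection of limit ultrapowers induced by a bijection of sets. -/
def powerEquiv {M N : Type u} (e : M ≃ N) : P.Power M ≃ P.Power N :=
  Quotient.congr (ra := P.limitSetoid M) (rb := P.limitSetoid N)
    { toFun := P.mapFun e
      invFun := P.mapFun e.symm
      left_inv := fun _ => Subtype.ext (funext fun _ => e.symm_apply_apply _)
      right_inv := fun _ => Subtype.ext (funext fun _ => e.apply_symm_apply _) }
    fun _ _ => Filter.eventually_congr (.of_forall fun _ => e.apply_eq_iff_eq.symm)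

/-- The isomorphism of limit ultrapowers induced by an isomorphism. -/
def powerIso {A B : Str τ} (e : Iso A B) : Iso (P.power A) (P.power B) where
  equiv s := P.powerEquiv (e.equiv s)
  map_rel r x := by
    obtain ⟨g, rfl⟩ := exists_toPower_eq x
    exact (power_rel A r g).trans ((Filter.eventually_congr (.of_forall fun j =>
      e.map_rel r _)).trans (power_rel B r fun i => P.mapFun (e.equiv _) (g i)).symm)
  map_func f x := by
    obtain ⟨g, rfl⟩ := exists_toPower_eq x
    refine (congrArg (P.powerEquiv (e.equiv _)) (power_func A f g)).trans (Eq.trans ?_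
      (power_func B f fun i => P.mapFun (e.equiv _) (g i)).symm)
    exact congrArg P.toPower (Subtype.ext (funext fun j => e.map_func f _))
  map_const c := congrArg P.toPower (Subtype.ext (funext fun _ => e.map_const c))

end LimitUltrafilter

theorem AbstractLogic.mem_limitFamily_of_equivalent {L : AbstractLogic.{u, v}}
    {P : LimitUltrafilter.{u}} {nu : Cardinal.{u}}
    (h : ∀ (τ : Vocab.{u}) (A : Str τ), A.card ≤ nu → L.Equivalent A (P.power A)) :
    (P, nu) ∈ L.limitFamily := fun _ A hA =>
  (h _ (A.expand (constInterp fun _ a => a)) hA).trans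
    (.of_iso (Str.isoExpandConst (P.power (A.expand _)) fun _ _ => rfl))

/-! ### Complete structures -/

/-- A structure is complete if each relation, function and element of it is the value of a symbol
of the vocabulary. -/
structure Str.IsComplete {τ : Vocab.{u}} (A : Str τ) : Prop where
  exists_rel : ∀ {n : ℕ} {s : Fin n → τ.Srt} (R : (∀ i, A.carrier (s i)) → Prop),
    ∃ r : τ.sig.Rel s, A.interp.rel r = R
  exists_func : ∀ {n : ℕ} {s : Fin n → τ.Srt} {t : τ.Srt}
    (F : (∀ i, A.carrier (s i)) → A.carrier t), ∃ f : τ.sig.Func s t, A.interp.func f = F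
  exists_const : ∀ {t : τ.Srt} (a : A.carrier t), ∃ c : τ.sig.Const t, A.interp.const c = a

/-- Symbols for all relations, functions and elements of the domains `M`. -/
def completeSig {S : Type u} (M : S → Type u) : Signature.{u} S where
  Rel s := (∀ i, M (s i)) → Prop
  Func s t := (∀ i, M (s i)) → M t
  Const t := M t

/-- The interpretation of the symbols of `completeSig M` by themselves. -/
def completeInterp {S : Type u} (M : S → Type u) : Interp (completeSig M) M where
  rel R x := R x
  func F x := F x
  const a := a

/-- The expansion of a structure by symbols for all its relations, functions and elements. -/
def Str.complete {τ : Vocab.{u}} (A : Str τ) : Str (τ.extend (completeSig A.carrier)) :=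
  A.expand (completeInterp A.carrier)

theorem Str.complete_isComplete {τ : Vocab.{u}} (A : Str τ) : A.complete.IsComplete where
  exists_rel R := ⟨Sum.inr R, rfl⟩
  exists_func F := ⟨Sum.inr F, rfl⟩
  exists_const a := ⟨Sum.inr a, rfl⟩

namespace Str.IsComplete

variable {L : AbstractLogic.{u, v}} {σ τ : Vocab.{u}} {A B : Str τ}

theorem expand (hA : A.IsComplete) {E : Signature.{u} τ.Srt} (J : Interp E A.carrier) :
    (A.expand J).IsComplete where
  exists_rel R := (hA.exists_rel R).imp' Sum.inl fun _ hr => hr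
  exists_func F := (hA.exists_func F).imp' Sum.inl fun _ hf => hf
  exists_const a := (hA.exists_const a).imp' Sum.inl fun _ hc => hc

theorem exists_isElementary (hA : A.IsComplete) (hL : L.IsRegular) (hAB : L.Equivalent A B) :
    ∃ h : ∀ s, A.carrier s → B.carrier s, L.IsElementary A B h := by
  choose c hc using fun t => hA.exists_const (t := t)
  refine ⟨fun t a => B.interp.const (c t a), fun φ => ?_⟩
  obtain ⟨ψ, hψ⟩ := hL.exists_rename_const (VocabHom.id τ) Function.injective_id c φ
  have hA' : A.expand (constInterp fun t a => A.interp.const (c t a)) =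
      A.expand (constInterp fun _ a => a) := by simp only [hc]
  rw [← hA']
  exact (hψ A).symm.trans ((hAB ψ).trans (hψ B))

theorem exists_iso_reduct (hA : A.IsComplete) {C : Str σ} {g : σ.Srt → τ.Srt}
    (hg : Function.Injective g) (e : ∀ s, C.carrier s ≃ A.carrier (g s)) :
    ∃ ρ : VocabHom σ τ, Function.Injective ρ.srt ∧ Nonempty (Iso C (A.reduct ρ)) := by
  choose rel hrel using fun {n : ℕ} {s : Fin n → σ.Srt} (r : σ.sig.Rel s) =>
    hA.exists_rel (s := fun i => g (s i)) fun x => C.interp.rel r fun i => (e (s i)).symm (x i)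
  choose func hfunc using fun {n : ℕ} {s : Fin n → σ.Srt} {t : σ.Srt} (f : σ.sig.Func s t) =>
    hA.exists_func (s := fun i => g (s i)) fun x =>
      e t (C.interp.func f fun i => (e (s i)).symm (x i))
  choose const hconst using fun {t : σ.Srt} (c : σ.sig.Const t) =>
    hA.exists_const (e t (C.interp.const c))
  have hsymm {n : ℕ} {s : Fin n → σ.Srt} (x : ∀ i, C.carrier (s i)) :
      (fun i => (e (s i)).symm (e (s i) (x i))) = x :=
    funext fun i => (e (s i)).symm_apply_apply (x i)
  refine ⟨⟨g, rel, func, const⟩, hg, ⟨⟨e, fun r x => ?_, fun f x => ?_, fun c => ?_⟩⟩⟩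
  · exact iff_of_eq ((congrFun (hrel r) _).trans (congrArg (C.interp.rel r) (hsymm x))).symm
  · exact ((congrFun (hfunc f) _).trans
      (congrArg (fun y => e _ (C.interp.func f y)) (hsymm x))).symm
  · exact (hconst c).symm

theorem equivalent_power_of_equiv (hA : A.IsComplete) (hL : L.IsRegular)
    {P : LimitUltrafilter.{u}} (hAP : L.Equivalent A (P.power A)) {C : Str σ}
    {g : σ.Srt → τ.Srt} (hg : Function.Injective g) (e : ∀ s, C.carrier s ≃ A.carrier (g s)) :
    L.Equivalent C (P.power C) := by
  obtain ⟨ρ, hρ, ⟨i⟩⟩ := hA.exists_iso_reduct hg e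
  exact ((AbstractLogic.Equivalent.of_iso i).trans (hAP.reduct hL ρ hρ)).trans
    (.of_iso (P.powerIso i.symm))

end Str.IsComplete

/-! ### Łoś's theorem for the family `F(L)` -/

theorem AbstractLogic.eventually_iff_of_mem_limitFamily {L : AbstractLogic.{u, v}}
    (hL : L.IsRegular) {P : LimitUltrafilter.{u}} {nu : Cardinal.{u}}
    (hP : (P, nu) ∈ L.limitFamily) {τ : Vocab.{u}} {A : Str τ} (hA : A.card ≤ nu) {n : ℕ}
    {s : Fin n → τ.Srt} {Q : ∀ A : Str τ, (∀ i, A.carrier (s i)) → Prop}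
    (hQ : L.Expressible s Q) (g : ∀ i, P.LimitFun (A.carrier (s i))) :
    Q (P.power A) (fun i => P.toPower (g i)) ↔
      ∀ᶠ j in (P.D : Filter P.I), Q A fun i => (g i).1 j := by
  let τ' := τ.extend (completeSig A.carrier)
  let R : τ'.sig.Rel s := Sum.inr fun x => Q A x
  have hR : L.Expressible (τ := τ') s fun C x =>
      C.interp.rel R x ↔ Q (C.reduct (τ.incl _)) x :=
    hL.expressible_iff (hL.expressible_rel (τ := τ') id R)
      (hL.expressible_reduct (τ.incl _) Function.injective_id hQ)
  have hequiv : L.Equivalent A.complete (P.power A.complete) := (hP τ' A.complete hA).equivalent hL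
  exact ((hequiv.forall_iff hL hR).1 (fun _ => Iff.rfl) _).symm.trans
    (LimitUltrafilter.power_rel A.complete R g)

/-! ### Structures equivalent to a complete structure -/

theorem exists_forall_apply_eq_of_injective {ι X : Type*} {M : X → Type*} [∀ c, Nonempty (M c)]
    {f : ι → X} (hf : Function.Injective f) (x : ∀ i, M (f i)) :
    ∃ g : ∀ c, M c, ∀ i, g (f i) = x i := by
  let e := Equiv.ofInjective f hf
  obtain ⟨g, hg⟩ := Subtype.surjective_restrict (β := M) (· ∈ Set.range f)
    (Equiv.piCongrLeft (fun c : Set.range f => M c) e x)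
  exact ⟨g, fun i => (congrFun hg (e i)).trans (Equiv.piCongrLeft_apply_apply
    (fun c : Set.range f => M c) e x i)⟩

theorem exists_eq_injective_comp {X : Type*} {n : ℕ} (b : Fin n → X) :
    ∃ (m : ℕ) (b' : Fin m → X) (k : Fin n → Fin m), Function.Injective b' ∧
      b = fun i => b' (k i) := by
  obtain ⟨m, ⟨e⟩⟩ := Finite.exists_equiv_fin (Set.range b)
  exact ⟨m, fun j => e.symm j, fun i => e ⟨b i, i, rfl⟩,
    Subtype.val_injective.comp e.symm.injective, funext fun i =>
      (congrArg Subtype.val (e.symm_apply_apply ⟨b i, i, rfl⟩)).symm⟩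

theorem exists_eq_comp_of_eqSet_mem_iInf {X : Type*} {M : X → Type*} {N : Type*} [Nonempty N]
    {g : (∀ c, M c) → N} (hg : LimitUltrafilter.eqSet g ∈
      ⨅ c, Filter.principal (LimitUltrafilter.eqSet fun i : ∀ c, M c => i c)) :
    ∃ (n : ℕ) (b : Fin n → X) (G : (∀ k, M (b k)) → N), ∀ i, g i = G fun k => i (b k) := by
  obtain ⟨t, ht⟩ := (Filter.mem_iInf_finite _).1 hg
  rw [Filter.iInf_principal_finset, Filter.mem_principal] at ht
  have hfactor : g.FactorsThrough fun i k => i (t.equivFin.symm k) := fun i j hij =>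
    ht (a := (i, j)) <| Set.mem_iInter₂.2 fun c hc => show i c = j c by
      obtain ⟨k, hk⟩ := t.equivFin.symm.surjective ⟨c, hc⟩
      obtain rfl : (t.equivFin.symm k : X) = c := congrArg Subtype.val hk
      exact congrFun hij k
  obtain ⟨G, hG⟩ := (Function.factorsThrough_iff g).1 hfactor
  exact ⟨_, _, G, congrFun hG⟩


/-- The choices, for each element of `B`, of an element of `A` of the same sort. -/
abbrev Selector {τ : Vocab.{u}} (A B : Str τ) : Type u := ∀ b : Σ s, B.carrier s, A.carrier b.1

namespace Selector

variable {L : AbstractLogic.{u, v}} {τ : Vocab.{u}} {A B : Str τ}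

/-- The sets of all selectors mapping a tuple `b` of `B` to a tuple of `A` with the property `Q`,
for the expressible properties `Q` of `b`. -/
def truthSets (L : AbstractLogic.{u, v}) (A B : Str τ) : Set (Set (Selector A B)) :=
  {U | ∃ (n : ℕ) (b : Fin n → Σ s, B.carrier s)
    (Q : ∀ C : Str τ, (∀ k, C.carrier (b k).1) → Prop),
    L.Expressible (fun k => (b k).1) Q ∧ Q B (fun k => (b k).2) ∧ {i | Q A fun k => i (b k)} = U}

theorem inter_mem_truthSets (hL : L.IsRegular) {U U' : Set (Selector A B)}
    (hU : U ∈ truthSets L A B) (hU' : U' ∈ truthSets L A B) : U ∩ U' ∈ truthSets L A B := by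
  obtain ⟨n, b, Q, hQ, hb, rfl⟩ := hU
  obtain ⟨n', b', Q', hQ', hb', rfl⟩ := hU'
  obtain ⟨m, c, k, k', rfl, rfl⟩ : ∃ (m : ℕ) (c : Fin m → Σ s, B.carrier s)
      (k : Fin n → Fin m) (k' : Fin n' → Fin m), b = (fun i => c (k i)) ∧ b' = fun i => c (k' i) :=
    ⟨n + n', Fin.append b b', Fin.castAdd n', Fin.natAdd n, by simp, by simp⟩
  exact ⟨m, c, _, hL.expressible_and (hL.expressible_comp (s := fun i => (c i).1) k hQ)
    (hL.expressible_comp (s := fun i => (c i).1) k' hQ'), ⟨hb, hb'⟩, rfl⟩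

theorem nonempty_of_mem_truthSets (hL : L.IsRegular) (hAB : L.Equivalent A B)
    {U : Set (Selector A B)} (hU : U ∈ truthSets L A B) : U.Nonempty := by
  have (b : Σ s, B.carrier s) : Nonempty (A.carrier b.1) := A.nonempty _
  obtain ⟨n, b, Q, hQ, hb, rfl⟩ := hU
  obtain ⟨m, c, k, hc, rfl⟩ := exists_eq_injective_comp b
  obtain ⟨x, hx⟩ := (hAB.exists_iff hL
    (hL.expressible_comp (s := fun i => (c i).1) k hQ)).2 ⟨fun j => (c j).2, hb⟩
  obtain ⟨i, hi⟩ := exists_forall_apply_eq_of_injective (M := fun b => A.carrier b.1) hc x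
  exact ⟨i, by simpa only [Set.mem_ofPred_eq, hi] using hx⟩

/-- Whatever `L` expresses of a tuple of `B` holds in `A` for the values at this tuple of
`D`-almost all selectors. -/
def PreservesTruth (L : AbstractLogic.{u, v}) (D : Ultrafilter (Selector A B)) : Prop :=
  ∀ ⦃n : ℕ⦄ ⦃s : Fin n → τ.Srt⦄ ⦃Q : ∀ C : Str τ, (∀ k, C.carrier (s k)) → Prop⦄,
    L.Expressible s Q → ∀ y : ∀ k, B.carrier (s k), Q B y →
      ∀ᶠ i : Selector A B in (D : Filter (Selector A B)), Q A fun k => i ⟨s k, y k⟩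

theorem exists_preservesTruth (hL : L.IsRegular) (hAB : L.Equivalent A B) :
    ∃ D : Ultrafilter (Selector A B), PreservesTruth L D := by
  let F : Filter (Selector A B) := ⨅ U : truthSets L A B, Filter.principal U.1
  have : Nonempty (Selector A B) := ⟨fun b => (A.nonempty b.1).some⟩
  have hF : F.NeBot := Filter.iInf_neBot_of_directed
    (fun U U' => ⟨⟨_, inter_mem_truthSets hL U.2 U'.2⟩,
      Filter.principal_mono.2 Set.inter_subset_left,
      Filter.principal_mono.2 Set.inter_subset_right⟩)
    fun U => Filter.principal_neBot_iff.2 (nonempty_of_mem_truthSets hL hAB U.2)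
  exact ⟨Ultrafilter.of F, fun n s Q hQ y hy => Ultrafilter.of_le F <| Filter.mem_iInf_of_mem
    (⟨_, n, fun k => ⟨s k, y k⟩, Q, hQ, hy, rfl⟩ : truthSets L A B) (Filter.mem_principal_self _)⟩

/-- The limit ultrafilter given by an ultrafilter on selectors, for which the limit functions are
the functions depending on finitely many values of a selector. -/
def limit (D : Ultrafilter (Selector A B)) : LimitUltrafilter.{u} where
  I := Selector A B
  D := D
  V := ⨅ b, Filter.principal (LimitUltrafilter.eqSet fun i => i b)

/-- The evaluation of selectors at an element of `B`. -/
def eval (D : Ultrafilter (Selector A B)) {s : τ.Srt} (y : B.carrier s) :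
    (limit D).LimitFun (A.carrier s) :=
  ⟨fun i : Selector A B => i ⟨s, y⟩,
    Filter.mem_iInf_of_mem (⟨s, y⟩ : Σ s, B.carrier s) (Filter.mem_principal_self _)⟩

namespace PreservesTruth

variable {D : Ultrafilter (Selector A B)} {n : ℕ} {s : Fin n → τ.Srt}

theorem iff_eventually (hL : L.IsRegular) (hD : PreservesTruth L D)
    {Q : ∀ C : Str τ, (∀ k, C.carrier (s k)) → Prop} (hQ : L.Expressible s Q)
    (y : ∀ k, B.carrier (s k)) :
    Q B y ↔ ∀ᶠ i : Selector A B in (D : Filter (Selector A B)), Q A fun k => i ⟨s k, y k⟩ :=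
  ⟨hD hQ y, fun h => by_contra fun hn =>
    Ultrafilter.eventually_not.1 (hD (hL.expressible_not hQ) y hn) h⟩

theorem eventually_func (hL : L.IsRegular) (hD : PreservesTruth L D) {t : τ.Srt}
    (f : τ.sig.Func s t) (y : ∀ k, B.carrier (s k)) :
    ∀ᶠ i : Selector A B in (D : Filter (Selector A B)),
      A.interp.func f (fun k => i ⟨s k, y k⟩) = i ⟨t, B.interp.func f y⟩ :=
  hD (hL.expressible_func (s := (Fin.cons t s : Fin (n + 1) → τ.Srt)) Fin.succ 0 f)
    (Fin.cons (α := fun k => B.carrier ((Fin.cons t s : Fin (n + 1) → τ.Srt) k))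
      (B.interp.func f y) y) rfl

theorem eventually_const (hL : L.IsRegular) (hD : PreservesTruth L D) {t : τ.Srt}
    (c : τ.sig.Const t) :
    ∀ᶠ i : Selector A B in (D : Filter (Selector A B)),
      A.interp.const c = i ⟨t, B.interp.const c⟩ :=
  hD (hL.expressible_const (s := fun _ : Fin 1 => t) 0 c) (fun _ => B.interp.const c) rfl

theorem injective_toPower_eval (hL : L.IsRegular) (hD : PreservesTruth L D) (t : τ.Srt) :
    Function.Injective fun y : B.carrier t => (limit D).toPower (eval D y) := fun y z hyz =>
  (hD.iff_eventually hL (hL.expressible_eq (t := t) (0 : Fin 2) 1) ![y, z]).2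
    (LimitUltrafilter.toPower_eq_toPower.1 hyz)

theorem surjective_toPower_eval (hL : L.IsRegular) (hA : A.IsComplete) (hD : PreservesTruth L D)
    (t : τ.Srt) : Function.Surjective fun y : B.carrier t => (limit D).toPower (eval D y) := by
  intro q
  obtain ⟨g, rfl⟩ := LimitUltrafilter.toPower_surjective _ q
  have : Nonempty (A.carrier t) := A.nonempty t
  obtain ⟨n, b, G, hG⟩ := exists_eq_comp_of_eqSet_mem_iInf g.2
  obtain ⟨f, rfl⟩ := hA.exists_func (s := fun k => (b k).1) G
  refine ⟨B.interp.func f fun k => (b k).2, LimitUltrafilter.toPower_eq_toPower.2 ?_⟩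
  exact (hD.eventually_func hL f fun k => (b k).2).mono fun i hi => hi.symm.trans (hG i).symm

end PreservesTruth

end Selector

theorem Str.IsComplete.exists_iso_power {L : AbstractLogic.{u, v}} (hL : L.IsRegular)
    {τ : Vocab.{u}} {A B : Str τ} (hA : A.IsComplete) (hAB : L.Equivalent A B) :
    ∃ P : LimitUltrafilter.{u}, Nonempty (Iso B (P.power A)) := by
  obtain ⟨D, hD⟩ := Selector.exists_preservesTruth hL hAB
  refine ⟨Selector.limit D, ⟨⟨fun t => Equiv.ofBijective _
    ⟨hD.injective_toPower_eval hL t, hD.surjective_toPower_eval hL hA t⟩, fun r y => ?_,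
    fun f y => ?_, fun c => ?_⟩⟩⟩
  · exact (hD.iff_eventually hL (hL.expressible_rel id r) y).trans
      (LimitUltrafilter.power_rel A r fun k => Selector.eval D (y k)).symm
  · exact (LimitUltrafilter.toPower_eq_toPower.2
      ((hD.eventually_func hL f y).mono fun _ hi => hi.symm)).trans
        (LimitUltrafilter.power_func A f fun k => Selector.eval D (y k)).symm
  · exact LimitUltrafilter.toPower_eq_toPower.2
      ((hD.eventually_const hL c).mono fun _ hi => hi.symm)

/-! ### From compactness to extensions -/

/-- A structure with constants for the entries of a tuple is determined by its reduct and by this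
tuple. -/
def Str.isoWithTuple {τ : Vocab.{u}} {ι : Type} {s : ι → τ.Srt}
    (C : Str (τ.extend (tupleSig s))) :
    Iso C ((C.reduct (τ.incl _)).withTuple fun i => C.interp.const (Sum.inr ⟨⟨i, rfl⟩⟩)) :=
  C.isoExpandConst fun _ ⟨_, h⟩ => by subst h; rfl

namespace AbstractLogic

variable {L : AbstractLogic.{u, v}} {lam : Cardinal.{u}} {V₀ V : Set (Set (Base lam))}

theorem IsCompactRelTo.exists_equivalent_realization (hL : L.IsRegular)
    (h : L.IsCompactRelTo lam V₀) {τ : Vocab.{u}} {ι : Type} {s : ι → τ.Srt} (A : Str τ)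
    {Q : V₀ → ∀ C : Str τ, (∀ i, C.carrier (s i)) → Prop} (hQ : ∀ w, L.Expressible s (Q w))
    (hA : ∀ γ, ∃ a, ∀ w : V₀, γ ∉ w.1 → Q w A a) :
    ∃ B : Str τ, L.Equivalent A B ∧ ∃ x, ∀ w, Q w B x := by
  choose φ hφ using hQ
  obtain ⟨C, hC⟩ := h _ {ψ | ∀ a, L.Sat (A.withTuple a) ψ} φ fun γ => by
    obtain ⟨a, ha⟩ := hA γ
    refine ⟨A.withTuple a, ?_⟩
    rintro _ (hψ | ⟨w, hw, rfl⟩)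
    exacts [hψ a, (hφ w A a).2 (ha w hw)]
  refine ⟨C.reduct (τ.incl _), .of_forall_imp hL fun χ hχ => ?_,
    fun i => C.interp.const (Sum.inr ⟨⟨i, rfl⟩⟩), fun w => ?_⟩
  · obtain ⟨ψ, hψ⟩ :=
      hL.exists_rename_of_srt_injective (τ.incl (tupleSig s)) Function.injective_id χ
    exact (hψ C).1 (hC ψ (.inl fun a => (hψ (A.withTuple a)).2 hχ))
  · exact (hφ w _ _).1 ((L.sat_iso _ _ C.isoWithTuple _).1 (hC _ (.inr ⟨w, rfl⟩)))

theorem IsCompactRelTo.expansionsExtend (hL : L.IsRegular) (h : L.IsCompactRelTo lam V₀)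
    {mu : Cardinal.{u}} (hlam : ℵ₀ ≤ lam) {W : Set (Set (Base lam))}
    (hV₀ : IsCofinalFamily Set.univ lam V₀) (hV : IsCofinalFamily Set.univ lam V) :
    L.ExpansionsExtend lam mu hlam V W := by
  rintro τ ρ _ A ⟨e⟩
  let τ' := τ.extend (completeSig A.carrier)
  let s : Fin 1 → τ.Srt := fun _ => ρ.srt PUnit.unit
  let e₀ : A.carrier (ρ.srt PUnit.unit) ≃ Base lam := e.equiv PUnit.unit
  let R (w : Set (Base lam)) : τ'.sig.Rel s := Sum.inr fun a => e₀ (a 0) ∈ w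
  have hR (w) : L.Expressible (τ := τ') s fun C x => C.interp.rel (R w) x :=
    hL.expressible_rel (τ := τ') (s := s) id (R w)
  obtain ⟨B, hAB, x, hx⟩ := h.exists_equivalent_realization hL (τ := τ') (s := s)
    A.complete (Q := fun w C x => ¬ C.interp.rel (R w.1) x)
    (fun w => hL.expressible_not (hR w))
    fun γ => ⟨fun _ => e₀.symm γ, fun w hw (hmem : e₀ (e₀.symm γ) ∈ w.1) =>
      hw (by rwa [e₀.apply_symm_apply] at hmem)⟩
  obtain ⟨g, hg⟩ := A.complete_isComplete.exists_isElementary hL hAB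
  refine ⟨B.reduct (τ.incl _), _, hg.reduct hL (τ.incl _) Function.injective_id, x 0,
    fun v hv hRv => ?_⟩
  obtain ⟨w, hw, hvw⟩ := hV₀.2 v (Set.subset_univ v) (hV.1 v hv).2
  let Rv : τ'.sig.Rel s := Sum.inl (ρ.rel (BaseRel.Rv ⟨v, Or.inl hv⟩))
  have hRvR : L.Expressible (τ := τ') s fun C x => C.interp.rel Rv x → C.interp.rel (R w) x :=
    hL.expressible_imp (hL.expressible_rel (τ := τ') (s := s) id Rv) (hR w)
  have hA (a : ∀ i, A.complete.carrier (s i)) (ha : A.complete.interp.rel Rv a) :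
      A.complete.interp.rel (R w) a :=
    hvw ((e.map_rel (BaseRel.Rv ⟨v, Or.inl hv⟩) a).1 ha)
  have hx0 : x = fun _ => x 0 := funext fun i => by rw [Subsingleton.elim i 0]
  exact hx ⟨w, hw⟩ ((hAB.forall_iff hL hRvR).1 hA x (hx0 ▸ hRv))

end AbstractLogic

/-! ### From extensions to limit ultrapowers -/

/-- The domains of a structure in which `lam` is a domain and every structure of cardinality at
most `nu` can be embedded by an injection of sorts and bijections of domains. -/
def universalDomain (lam nu : Cardinal.{u}) :
    Option {X : Set (Base nu) // X.Nonempty} → Type u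
  | none => Base lam
  | some X => X.1

theorem exists_injective_equiv_universalDomain (lam : Cardinal.{u}) {nu : Cardinal.{u}}
    {τ : Vocab.{u}} {C : Str τ} (hC : C.card ≤ nu) :
    ∃ g : τ.Srt → Option {X : Set (Base nu) // X.Nonempty}, Function.Injective g ∧
      Nonempty (∀ s, C.carrier s ≃ universalDomain lam nu (g s)) := by
  have hcard : #(Σ s, C.carrier s) ≤ #(Base nu) := by rwa [Cardinal.mk_ord_toType]
  obtain ⟨j⟩ := hcard
  have (s : τ.Srt) : Nonempty (C.carrier s) := C.nonempty s
  refine ⟨fun s => some ⟨Set.range fun a : C.carrier s => j ⟨s, a⟩, Set.range_nonempty _⟩,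
    fun s s' h => ?_,
    ⟨fun s => Equiv.ofInjective _ (j.injective.comp sigma_mk_injective)⟩⟩
  have hrange : (Set.range fun a : C.carrier s => j ⟨s, a⟩) =
      Set.range fun a : C.carrier s' => j ⟨s', a⟩ := congrArg Subtype.val (Option.some.inj h)
  obtain ⟨a⟩ := C.nonempty s
  obtain ⟨a', ha'⟩ := hrange.le ⟨a, rfl⟩
  exact (congrArg Sigma.fst (j.injective ha')).symm

/-- The complete structure on the domains `universalDomain lam nu`. -/
def universalStr {lam : Cardinal.{u}} (hlam : ℵ₀ ≤ lam) (nu : Cardinal.{u}) :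
    Str ⟨_, completeSig (universalDomain lam nu)⟩ where
  carrier := universalDomain lam nu
  nonempty
    | none => nonempty_base hlam
    | some X => X.2.to_subtype
  interp := completeInterp _

theorem universalStr_isComplete {lam : Cardinal.{u}} (hlam : ℵ₀ ≤ lam) (nu : Cardinal.{u}) :
    (universalStr hlam nu).IsComplete where
  exists_rel R := ⟨R, rfl⟩
  exists_func F := ⟨F, rfl⟩
  exists_const a := ⟨a, rfl⟩

namespace AbstractLogic.ExpansionsExtend

variable {L : AbstractLogic.{u, v}} {lam mu : Cardinal.{u}} {hlam : ℵ₀ ≤ lam}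
  {V W : Set (Set (Base lam))}

theorem exists_isDecomposable_equivalent_power (hL : L.IsRegular)
    (hV : IsCofinalFamily Set.univ lam V) (h : L.ExpansionsExtend lam mu hlam V W)
    {τ : Vocab.{u}} {A : Str τ} (hA : A.IsComplete) {t : τ.Srt} (e : A.carrier t ≃ Base lam) :
    ∃ P : LimitUltrafilter.{u}, P.IsDecomposable lam ∧ L.Equivalent A (P.power A) := by
  let g : (baseVocab (V ∪ W)).Srt → τ.Srt := fun _ => t
  let J : Interp (baseVocab (V ∪ W)).sig fun s => A.carrier (g s) :=
    { rel := fun r x =>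
        (baseModel (nonempty_base hlam) (below lam mu) (V ∪ W)).interp.rel r fun i => e (x i)
      func := fun f => nomatch f
      const := fun c => nomatch c }
  obtain ⟨B, _, hAB, x, hx⟩ := h _ (VocabHom.toMap (baseVocab (V ∪ W)) τ g)
    (VocabHom.toMap_isInjective fun _ _ _ => rfl) (A.expand J.map)
    ⟨⟨fun _ => e, fun _ _ => Iff.rfl, (fun f => nomatch f), fun c => nomatch c⟩⟩
  obtain ⟨P, ⟨i⟩⟩ := (hA.expand J.map).exists_iso_power hL (hAB.equivalent hL)
  refine ⟨P, ?_, ((hAB.equivalent hL).trans (.of_iso i)).reduct hL (τ.incl _)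
    Function.injective_id⟩
  obtain ⟨f, hf⟩ := LimitUltrafilter.toPower_surjective _ (i.equiv t x)
  refine ⟨fun j => e (f.1 j), (P.mapFun e f).2, fun v hv hmem => ?_⟩
  obtain ⟨w, hw, hvw⟩ := hV.2 v (Set.subset_univ v) hv
  refine hx w hw ((i.map_rel (Sum.inr (.mk (BaseRel.Rv ⟨w, Or.inl hw⟩))) fun _ => x).2 ?_)
  rw [← hf]
  exact (LimitUltrafilter.power_rel _ _ fun _ => f).2
    (Filter.mem_of_superset hmem fun _ hj => hvw hj)

theorem exists_isDecomposable_mem_limitFamily (hL : L.IsRegular)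
    (hV : IsCofinalFamily Set.univ lam V) (h : L.ExpansionsExtend lam mu hlam V W)
    (nu : Cardinal.{u}) :
    ∃ P : LimitUltrafilter.{u}, P.IsDecomposable lam ∧ (P, nu) ∈ L.limitFamily := by
  have hU := universalStr_isComplete hlam nu
  obtain ⟨P, hP, hUP⟩ := h.exists_isDecomposable_equivalent_power hL hV hU (t := none)
    (Equiv.refl (Base lam))
  refine ⟨P, hP, mem_limitFamily_of_equivalent fun τ C hC => ?_⟩
  obtain ⟨g, hg, ⟨e⟩⟩ := exists_injective_equiv_universalDomain lam hC
  exact hU.equivalent_power_of_equiv hL hUP hg e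

end AbstractLogic.ExpansionsExtend

/-! ### Families of structures -/

/-- The sorts `s i` preceded by the new sort `none`. -/
abbrev consNone {S : Type u} {n : ℕ} (s : Fin n → S) : Fin (n + 1) → Option S :=
  Fin.cons none fun i => some (s i)

/-- The tuple consisting of `x` and the `y i`. -/
def consTuple {S : Type u} {M : Option S → Type u} {n : ℕ} {s : Fin n → S} (x : M none)
    (y : ∀ i, M (some (s i))) : ∀ i, M (consNone s i) :=
  Fin.cons (α := fun i => M (consNone s i)) x y

/-- Relation symbols for families of `τ`-structures: those of `τ`, with an additional argument
of the new sort `none` of indices. -/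
inductive FibreRel (τ : Vocab.{u}) : {n : ℕ} → (Fin n → Option τ.Srt) → Type u
  | rel {n : ℕ} {s : Fin n → τ.Srt} (r : τ.sig.Rel s) : FibreRel τ (consNone s)

/-- Function symbols for families of `τ`-structures: the function and constant symbols of `τ`,
with an additional argument, and projections of all sorts to the sort `none`. -/
inductive FibreFunc (τ : Vocab.{u}) :
    {n : ℕ} → (Fin n → Option τ.Srt) → Option τ.Srt → Type u
  | func {n : ℕ} {s : Fin n → τ.Srt} {t : τ.Srt} (f : τ.sig.Func s t) :
      FibreFunc τ (consNone s) (some t)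
  | const {t : τ.Srt} (c : τ.sig.Const t) : FibreFunc τ (fun _ : Fin 1 => none) (some t)
  | proj (t : τ.Srt) : FibreFunc τ (fun _ : Fin 1 => some t) none

/-- The vocabulary of families of `τ`-structures. -/
def fibreVocab (τ : Vocab.{u}) : Vocab.{u} where
  Srt := Option τ.Srt
  sig :=
    { Rel := fun s => FibreRel τ s
      Func := fun s t => FibreFunc τ s t
      Const := fun _ => PEmpty }

variable {τ : Vocab.{u}}

namespace Str

/-- The index of an element of a family of structures. -/
def proj (N : Str (fibreVocab τ)) {t : τ.Srt} (y : N.carrier (some t)) : N.carrier none :=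
  N.interp.func (FibreFunc.proj t) fun _ => y

/-- The values of the symbols of `τ` have the index given by the additional argument, and each
sort has elements of each index. -/
structure IsFibred (N : Str (fibreVocab τ)) : Prop where
  func : ∀ {n : ℕ} {s : Fin n → τ.Srt} {t : τ.Srt} (f : τ.sig.Func s t)
    (z : ∀ i, N.carrier (consNone s i)), N.proj (N.interp.func (FibreFunc.func f) z) = z 0
  const : ∀ {t : τ.Srt} (c : τ.sig.Const t) (x : Fin 1 → N.carrier none),
    N.proj (N.interp.func (FibreFunc.const c) x) = x 0
  surjective : ∀ t : τ.Srt, Function.Surjective (N.proj (t := t))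

/-- The `τ`-structure on the elements of all indices given by the value `x` of the additional
argument. -/
def atIndex (N : Str (fibreVocab τ)) (x : N.carrier none) : Str τ where
  carrier s := N.carrier (some s)
  nonempty s := N.nonempty (some s)
  interp :=
    { rel := fun r y => N.interp.rel (FibreRel.rel r) (consTuple x y)
      func := fun f y => N.interp.func (FibreFunc.func f) (consTuple x y)
      const := fun c => N.interp.func (FibreFunc.const c) fun _ => x }

/-- The elements of index `x`. -/
def fibreSet (N : Str (fibreVocab τ)) (x : N.carrier none) (t : τ.Srt) :
    Set ((N.atIndex x).carrier t) :=
  {y | N.proj y = x}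

theorem IsFibred.isClosed {N : Str (fibreVocab τ)} (hN : N.IsFibred) (x : N.carrier none) :
    (N.atIndex x).IsClosed (N.fibreSet x) where
  nonempty t := hN.surjective t x
  func f y _ := hN.func f (consTuple x y)
  const c := hN.const c fun _ => x

/-- The member of index `x` of a family of structures. -/
def fibre (N : Str (fibreVocab τ)) (hN : N.IsFibred) (x : N.carrier none) : Str τ :=
  (N.atIndex x).restrict (N.fibreSet x) (hN.isClosed x)

end Str

/-! ### Definability of the members of a family -/

/-- The vocabulary of families of `τ`-structures with a distinguished index. -/
abbrev pointedVocab (τ : Vocab.{u}) : Vocab.{u} :=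
  (fibreVocab τ).extend (tupleSig fun _ : Fin 1 => none)

/-- The symbol for the distinguished index. -/
def pointConst (τ : Vocab.{u}) : (pointedVocab τ).sig.Const none := Sum.inr ⟨⟨0, rfl⟩⟩

/-- The member at the distinguished index of a family of structures, as an interpretation of `τ`
and of unary relation symbols for its domains. -/
def fibreInterp (N : Str (pointedVocab τ)) :
    Interp (τ.extend (unarySig τ.Srt)).sig fun s => N.carrier (some s) :=
  let N' := N.reduct ((fibreVocab τ).incl _)
  let x : N'.carrier none := N.interp.const (pointConst τ)
  ((N'.atIndex x).expand (unaryInterp (N'.fibreSet x))).interp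

namespace AbstractLogic

variable {L : AbstractLogic.{u, v}}

/-- The distinguished index as a term. -/
def pointTerm {ι : Type} (s : ι → (pointedVocab τ).Srt) :
    ClosedTerm ((pointedVocab τ).extend (tupleSig s)) none :=
  .const (τ := (pointedVocab τ).extend (tupleSig s)) (Sum.inl (pointConst τ))

/-- The distinguished index followed by given terms. -/
def pointArgTerm {ι : Type} (s : ι → (pointedVocab τ).Srt) {n : ℕ} {s' : Fin n → τ.Srt}
    (a : ∀ i, ClosedTerm ((pointedVocab τ).extend (tupleSig s)) (some (s' i))) :
    ∀ i, ClosedTerm ((pointedVocab τ).extend (tupleSig s)) (consNone s' i) :=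
  consTuple (pointTerm s) a

theorem eval_pointArgTerm {ι : Type} (s : ι → (pointedVocab τ).Srt) {n : ℕ} {s' : Fin n → τ.Srt}
    (a : ∀ i, ClosedTerm ((pointedVocab τ).extend (tupleSig s)) (some (s' i)))
    (N : Str (pointedVocab τ)) (x : ∀ i, N.carrier (s i)) :
    (fun i => (pointArgTerm s a i).eval (N.withTuple x)) =
      consTuple (N.interp.const (pointConst τ)) fun i => (a i).eval (N.withTuple x) :=
  funext <| Fin.cases rfl fun _ => rfl

theorem fibreInterp_isDefinable (hL : L.IsRegular) : L.IsDefinable (fibreInterp (τ := τ)) where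
  rel := by
    rintro n s (r | r)
    · let s' (i : Fin n) : (pointedVocab τ).Srt := some (s i)
      obtain ⟨ψ, hψ⟩ := hL.expressible_atomic (.rel (τ := (pointedVocab τ).extend (tupleSig s'))
        (Sum.inl (Sum.inl (FibreRel.rel r))) (pointArgTerm s' fun i => argTerm s' i))
      exact ⟨ψ, fun N x => (hψ N x).trans (iff_of_eq
        (congrArg (N.interp.rel (Sum.inl (FibreRel.rel r)))
          (eval_pointArgTerm s' (fun i => argTerm s' i) N x)))⟩
    · obtain ⟨t⟩ := r
      let s' (_ : Fin 1) : (pointedVocab τ).Srt := some t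
      exact hL.expressible_atomic (.eq (τ := (pointedVocab τ).extend (tupleSig s'))
        (.app (Sum.inl (Sum.inl (FibreFunc.proj t))) fun _ => argTerm s' 0) (pointTerm s'))
  func := by
    rintro n s t (f | f)
    · let s' (o : Option (Fin n)) : (pointedVocab τ).Srt := o.elim (some t) fun i => some (s i)
      obtain ⟨ψ, hψ⟩ := hL.expressible_atomic (.eq (τ := (pointedVocab τ).extend (tupleSig s'))
        (.app (Sum.inl (Sum.inl (FibreFunc.func f)))
          (pointArgTerm s' fun i => argTerm s' (some i))) (argTerm s' none))
      exact ⟨ψ, fun N x => (hψ N x).trans (iff_of_eq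
        (congrArg (fun z => N.interp.func (Sum.inl (FibreFunc.func f)) z = x none)
          (eval_pointArgTerm s' (fun i => argTerm s' (some i)) N x)))⟩
    · exact nomatch f
  const := by
    rintro t (c | c)
    · let s' (_ : Unit) : (pointedVocab τ).Srt := some t
      exact hL.expressible_atomic (.eq (τ := (pointedVocab τ).extend (tupleSig s'))
        (.app (Sum.inl (Sum.inl (FibreFunc.const c))) fun _ => pointTerm s') (argTerm s' ()))
    · exact nomatch c

theorem IsRegular.exists_fibre_sentence (hL : L.IsRegular) (φ : L.Sentence τ) :
    ∃ ψ : L.Sentence (pointedVocab τ), ∀ (N : Str (fibreVocab τ)) (hN : N.IsFibred)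
      (x : Fin 1 → N.carrier none),
      L.Sat (N.withTuple (s := fun _ : Fin 1 => none) x) ψ ↔ L.Sat (N.fibre hN (x 0)) φ := by
  obtain ⟨φ', hφ'⟩ := hL.relativization φ
  obtain ⟨ψ, hψ⟩ :=
    (fibreInterp_isDefinable hL).exists_sentence hL (Option.some_injective _) φ'
  exact ⟨ψ, fun N hN x => (hψ _).trans
    (hφ' (N.atIndex (x 0)) (N.fibreSet (x 0)) (hN.isClosed (x 0)))⟩

end AbstractLogic

/-! ### The disjoint union of a family of structures -/

open Classical in
/-- The retraction of a disjoint union of structures to one of its parts: elements of the other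
parts have an arbitrary value. -/
noncomputable def toPart {Γ : Type u} (A : Γ → Str τ) (γ : Γ) {s : τ.Srt}
    (y : Σ γ, (A γ).carrier s) : (A γ).carrier s :=
  if h : y.1 = γ then h ▸ y.2 else ((A γ).nonempty s).some

theorem toPart_mk {Γ : Type u} (A : Γ → Str τ) (γ : Γ) {s : τ.Srt} (a : (A γ).carrier s) :
    toPart A γ ⟨γ, a⟩ = a := dif_pos rfl

variable {Γ : Type u} [hΓ : Nonempty Γ] (A : Γ → Str τ)

/-- The disjoint union of the structures `A γ`, with their indices as a new sort. -/
noncomputable def totalStr : Str (fibreVocab τ) where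
  carrier
    | none => Γ
    | some s => Σ γ, (A γ).carrier s
  nonempty
    | none => hΓ
    | some s => hΓ.elim fun γ => ((A γ).nonempty s).map (Sigma.mk γ)
  interp :=
    { rel := fun
        | .rel r, z =>
          (A (z 0)).interp.rel r fun i => toPart A (z 0) (z i.succ)
      func := fun
        | .func f, z =>
          ⟨z 0, (A (z 0)).interp.func f fun i => toPart A (z 0) (z i.succ)⟩
        | .const c, z => ⟨z 0, (A (z 0)).interp.const c⟩
        | .proj _, z => (z 0).1
      const := fun c => nomatch c }

theorem totalStr_isFibred : (totalStr A).IsFibred where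
  func _ _ := rfl
  const _ _ := rfl
  surjective t γ := ⟨⟨γ, ((A γ).nonempty t).some⟩, rfl⟩

/-- The members of the family `totalStr A` are the structures `A γ`. -/
noncomputable def fibreTotalIso (γ : Γ) :
    Iso (A γ) ((totalStr A).fibre (totalStr_isFibred A) γ) where
  equiv s :=
    { toFun := fun a => ⟨⟨γ, a⟩, rfl⟩
      invFun := fun y => toPart A γ y.1
      left_inv := fun a => toPart_mk A _ a
      right_inv := by
        rintro ⟨⟨_, a⟩, rfl⟩
        exact Subtype.ext (congrArg (Sigma.mk _) (toPart_mk A _ a)) }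
  map_rel {n s} r x :=
    iff_of_eq (congrArg ((A γ).interp.rel r) (funext fun i => (toPart_mk A γ (x i)).symm))
  map_func {n s t} f x := Subtype.ext (congrArg
    (fun y => (⟨γ, (A γ).interp.func f y⟩ : Σ γ, (A γ).carrier t))
    (funext fun i => (toPart_mk A γ (x i)).symm))
  map_const _ := rfl

/-! ### From limit ultrapowers to compactness -/

theorem Str.IsFibred.power (P : LimitUltrafilter.{u}) {N : Str (fibreVocab τ)}
    (hN : N.IsFibred) : (P.power N).IsFibred where
  func {n s t} f z := by
    obtain ⟨g, rfl⟩ := LimitUltrafilter.exists_toPower_eq z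
    refine (congrArg (P.power N).proj (P.power_func N (FibreFunc.func f) g)).trans
      ((LimitUltrafilter.power_func N (FibreFunc.proj t) fun _ => _).trans ?_)
    exact congrArg P.toPower (Subtype.ext (funext fun j => hN.func f _))
  const {t} c x := by
    obtain ⟨g, rfl⟩ := LimitUltrafilter.exists_toPower_eq x
    refine (congrArg (P.power N).proj (P.power_func N (FibreFunc.const c) g)).trans
      ((LimitUltrafilter.power_func N (FibreFunc.proj t) fun _ => _).trans ?_)
    exact congrArg P.toPower (Subtype.ext (funext fun j => hN.const c _))
  surjective t x := by
    obtain ⟨k, hk⟩ := (hN.surjective t).hasRightInverse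
    obtain ⟨g, rfl⟩ := LimitUltrafilter.toPower_surjective _ x
    refine ⟨P.toPower (P.mapFun k g),
      (LimitUltrafilter.power_func N (FibreFunc.proj t) fun _ => _).trans ?_⟩
    exact congrArg P.toPower (Subtype.ext (funext fun j => hk _))

namespace AbstractLogic

variable {L : AbstractLogic.{u, v}} {P : LimitUltrafilter.{u}}

theorem exists_sat_iff_eventually (hL : L.IsRegular) {nu : Cardinal.{u}}
    (hP : (P, nu) ∈ L.limitFamily) (hA : (totalStr A).card ≤ nu) (f : P.LimitFun Γ) :
    ∃ B : Str τ, ∀ χ, L.Sat B χ ↔ ∀ᶠ j in (P.D : Filter P.I), L.Sat (A (f.1 j)) χ := by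
  have hN := totalStr_isFibred A
  refine ⟨(P.power (totalStr A)).fibre (hN.power P) (P.toPower f), fun χ => ?_⟩
  obtain ⟨ψ, hψ⟩ := hL.exists_fibre_sentence χ
  refine (hψ _ (hN.power P) fun _ => P.toPower f).symm.trans
    ((eventually_iff_of_mem_limitFamily hL hP hA (s := fun _ : Fin 1 => none)
      (Q := fun N x => L.Sat (N.withTuple x) ψ) ⟨ψ, fun _ _ => Iff.rfl⟩ fun _ => f).trans
    (Filter.eventually_congr (.of_forall fun j => ?_)))
  exact (hψ _ hN _).trans (L.sat_iso _ _ (fibreTotalIso A (f.1 j)) χ).symm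

theorem isCompactRelTo_of_limitFamily (hL : L.IsRegular) {lam : Cardinal.{u}} (hlam : ℵ₀ ≤ lam)
    {V₀ : Set (Set (Base lam))} (hV₀ : IsCofinalFamily Set.univ lam V₀)
    (h : ∀ nu : Cardinal.{u}, ℵ₀ ≤ nu →
      ∃ P : LimitUltrafilter.{u}, P.IsDecomposable lam ∧ (P, nu) ∈ L.limitFamily) :
    L.IsCompactRelTo lam V₀ := by
  intro τ T φ hT
  have : Nonempty (Base lam) := nonempty_base hlam
  choose A hA using hT
  obtain ⟨P, ⟨f, hfV, hfD⟩, hP⟩ := h (max ℵ₀ (totalStr A).card) (le_max_left _ _)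
  obtain ⟨B, hB⟩ := exists_sat_iff_eventually A hL hP (le_max_right _ _) ⟨f, hfV⟩
  refine ⟨B, ?_⟩
  rintro _ (hχ | ⟨v, rfl⟩)
  · exact (hB _).2 (.of_forall fun j => hA _ _ (.inl hχ))
  · have hfv : ∀ᶠ j in (P.D : Filter P.I), f j ∉ v.1 :=
      Ultrafilter.eventually_not.2 (hfD v.1 (hV₀.1 v.1 v.2).2)
    exact (hB _).2 (hfv.mono fun j hj => hA _ _ (.inr ⟨v, hj, rfl⟩))

end AbstractLogic

end ManySorted

theorem mainTheorem4_general (L : ManySorted.AbstractLogic.{u, v}) (hL : L.IsRegular)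
    (lam mu : Cardinal.{u}) (hlam : ℵ₀ ≤ lam)
    (V₀ : Set (Set (ManySorted.Base lam)))
    (hV₀ : ManySorted.IsCofinalFamily Set.univ lam V₀)
    (V : Set (Set (ManySorted.Base lam)))
    (hV : ManySorted.IsCofinalFamily Set.univ lam V)
    (W : Set (Set (ManySorted.Base lam))) :
    List.TFAE
      [L.IsCompactRelTo lam V₀,
       L.ExpansionsExtend lam mu hlam V W,
       ∀ nu : Cardinal.{u}, ℵ₀ ≤ nu →
         ∃ P : ManySorted.LimitUltrafilter.{u},
           P.IsDecomposable lam ∧ (P, nu) ∈ L.limitFamily] := by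
  tfae_have 1 → 2 := fun h => h.expansionsExtend hL hlam hV₀ hV
  tfae_have 2 → 3 := fun h nu _ => h.exists_isDecomposable_mem_limitFamily hL hV nu
  tfae_have 3 → 1 := ManySorted.AbstractLogic.isCompactRelTo_of_limitFamily hL hlam hV₀
  tfae_finish

theorem mainTheorem4 (L : ManySorted.AbstractLogic.{u, v}) (hL : L.IsRegular)
    (lam mu : Cardinal.{u}) (hmu : ℵ₀ ≤ mu) (hle : mu ≤ lam)
    (V₀ : Set (Set (ManySorted.Base lam)))
    (hV₀ : ManySorted.IsCofinalFamily Set.univ lam V₀)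
    (V : Set (Set (ManySorted.Base lam)))
    (hV : ManySorted.IsCofinalFamily Set.univ lam V)
    (W : Set (Set (ManySorted.Base lam)))
    (hW : ManySorted.IsCofinalFamily (ManySorted.below lam mu) mu W) :
    List.TFAE
      [L.IsCompactRelTo lam V₀,
       L.ExpansionsExtend lam mu (hmu.trans hle) V W,
       ∀ nu : Cardinal.{u}, ℵ₀ ≤ nu →
         ∃ P : ManySorted.LimitUltrafilter.{u}, P.IsDecomposable lam ∧ (P, nu) ∈ L.limitFamily] :=
  mainTheorem4_general L hL lam mu (hmu.trans hle) V₀ hV₀ V hV W
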